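/- For $n\ge 1$ let $A^{(n)}\in\{0,1\}^{n\times n}$ be the lower triangular all-ones matrix, i.e. $A^{(n)}_{i,j}=1$ if $i\ge j$ and $0$ otherwise. For a factorization $A^{(n)}=BC$ with $B,C^{T}\in\mathbb{R}^{n\times k}$ (any $k$) let $$\mathrm{MaxErr}(B,C)=\sqrt{\max_i\sum_j B_{i,j}^2}\cdot\sqrt{\max_j\sum_i C_{i,j}^2},$$ and let $\mathsf{Opt}(n)=\inf\{\mathrm{MaxErr}(B_*,C_*) : B_*C_*=A^{(n)}\}$ be the infimum over all real factorizations, of every inner dimension. A streaming algorithm is a program of a machine with finitely many directly addressed registers, each of which holds one real number. Its instructions load a real constant, add, subtract or multiply registers, read the next number of the input stream (which cannot be rewound), or append a register to the output stream; programs are formed from these by sequential composition, tests whether a register is positive, and loops with a prescribed number of rounds. Every instruction, test and loop round costs one unit of time. The space is the number of registers plus the length of the program, including its constants and loop counters. A matrix is streamed row by row. **Theorem.** There is a universal constant $K>0$, which is the constant in every $O(\cdot)$ below, such that $\mathsf{Opt}(n)=\frac{\log n}{\pi}\pm O(1)$ for all $n\ge 1$, and the following holds for all integers $n\ge 2$,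 $n_1\ge 2$ and $m\ge 1$. There exist an integer $n'\le O(n)$, matrices $B,C^{T}\in\mathbb{R}^{n\times n'}$ and a streaming algorithm $\mathcal{A}$ such that: * (Valid matrix factorization) $BC=A^{(n)}$. * (Near-optimality) $$\mathrm{MaxErr}(B,C)\le \mathsf{Opt}(n)\cdot\left(1+O\left(\frac{1}{\log n_1}\right)\right)+O(\log n_1).$$ * (Valid algorithm) For every $Z\in\mathbb{R}^{n'\times m}$, on the input stream of the rows of $Z$, each of which is read exactly once, $\mathcal{A}$ outputs the stream of the rows of $B Z\in\mathbb{R}^{n\times m}$. * (Efficient algorithm) $\mathcal{A}$ uses space $O(\log (n)\log (n_1)\, m)$ and has total runtime $O(n\log (n_1)^2\, m)$. -/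

import Mathlib

/-- The all-ones lower triangular matrix `A⁽ⁿ⁾`. -/
def prefixSumMatrix (n : ℕ) : Matrix (Fin n) (Fin n) ℝ :=
  Matrix.of fun i j => if j ≤ i then 1 else 0

/-- `‖B‖_{2→∞} · ‖C‖_{1→2}`: the largest Euclidean norm of a row of `B` times the largest
Euclidean norm of a column of `C`. -/
noncomputable def MaxErr {n k : ℕ} (B : Matrix (Fin n) (Fin k) ℝ) (C : Matrix (Fin k) (Fin n) ℝ) :
    ℝ :=
  Real.sqrt (⨆ i : Fin n, ∑ j : Fin k, B i j ^ 2) *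
    Real.sqrt (⨆ j : Fin n, ∑ i : Fin k, C i j ^ 2)

/-- The infimum of `MaxErr` over all real factorizations of `A⁽ⁿ⁾`, of every inner dimension. -/
noncomputable def Opt (n : ℕ) : ℝ :=
  sInf {x : ℝ | ∃ (k : ℕ) (B : Matrix (Fin n) (Fin k) ℝ) (C : Matrix (Fin k) (Fin n) ℝ),
    B * C = prefixSumMatrix n ∧ x = MaxErr B C}

/-- Programs of a streaming machine with `s` registers, each holding one real number
(real arithmetic is atomic). There is no indirect addressing. -/
inductive StreamProg (s : ℕ) : Type
  /-- do nothing -/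
  | skip : StreamProg s
  /-- load the constant `c` into register `r` -/
  | const (r : Fin s) (c : ℝ) : StreamProg s
  /-- `r := a + b` -/
  | add (r a b : Fin s) : StreamProg s
  /-- `r := a - b` -/
  | sub (r a b : Fin s) : StreamProg s
  /-- `r := a * b` -/
  | mul (r a b : Fin s) : StreamProg s
  /-- move the next number of the input stream into register `r` -/
  | read (r : Fin s) : StreamProg s
  /-- append the content of register `r` to the output stream -/
  | write (r : Fin s) : StreamProg s
  /-- run the two programs one after the other -/
  | seq (p q : StreamProg s) : StreamProg s
  /-- run `p` if register `r` is positive, and `q` otherwise -/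
  | ifPos (r : Fin s) (p q : StreamProg s) : StreamProg s
  /-- run `p` exactly `k` times -/
  | loop (k : ℕ) (p : StreamProg s) : StreamProg s

/-- A configuration of the machine: the registers, the part of the input stream that is still
unread, the (write-only) output stream so far, and the number of steps made so far. -/
structure StreamConfig (s : ℕ) : Type where
  reg : Fin s → ℝ
  inp : List ℝ
  out : List ℝ
  time : ℕ

namespace StreamConfig

/-- The initial configuration on a given input stream: all registers are zero. -/
def init (s : ℕ) (input : List ℝ) : StreamConfig s :=
  { reg := fun _ => 0, inp := input, out := [], time := 0 }

/-- Let one time step pass. -/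
def tick {s : ℕ} (c : StreamConfig s) : StreamConfig s :=
  { c with time := c.time + 1 }

/-- Store `x` in register `r`. -/
def set {s : ℕ} (c : StreamConfig s) (r : Fin s) (x : ℝ) : StreamConfig s :=
  { c with reg := Function.update c.reg r x }

end StreamConfig

namespace StreamProg

/-- Execution of a program. It fails (`none`) if a number is requested after the end of the
input stream. Every instruction takes one step, every test takes one step, a loop takes one step
to start and one step per round, in addition to the steps of its body. -/
noncomputable def exec {s : ℕ} : StreamProg s → StreamConfig s → Option (StreamConfig s)
  | skip, c => some c.tick
  | const r x, c => some (c.tick.set r x)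
  | add r a b, c => some (c.tick.set r (c.reg a + c.reg b))
  | sub r a b, c => some (c.tick.set r (c.reg a - c.reg b))
  | mul r a b, c => some (c.tick.set r (c.reg a * c.reg b))
  | read r, c =>
      match c.inp with
      | [] => none
      | x :: rest => some ({ c.tick with inp := rest }.set r x)
  | write r, c => some { c.tick with out := c.out ++ [c.reg r] }
  | seq p q, c => (exec p c).bind (exec q)
  | ifPos r p q, c =>
      open Classical in if 0 < c.reg r then exec p c.tick else exec q c.tick
  | loop k p, c => (fun o => o.bind fun c' => exec p c'.tick)^[k] (some c.tick)

/-- The number of memory cells taken by the program text (a constant of the program is part of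
the instruction that loads it); a loop takes a second cell for its counter. -/
def size {s : ℕ} : StreamProg s → ℕ
  | skip => 1
  | const _ _ => 1
  | add _ _ _ => 1
  | sub _ _ _ => 1
  | mul _ _ _ => 1
  | read _ => 1
  | write _ => 1
  | seq p q => size p + size q
  | ifPos _ p q => size p + size q + 1
  | loop _ p => size p + 2

/-- The space used by a program: its registers together with the program itself, including the
constants and the loop counters. -/
def space {s : ℕ} (p : StreamProg s) : ℕ := s + size p

end StreamProg

/-- The rows of a matrix as a stream: the rows one after the other, each from left to right. -/
def rowStream {k m : ℕ} (Z : Matrix (Fin k) (Fin m) ℝ) : List ℝ :=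
  (List.ofFn fun i => List.ofFn fun j => Z i j).flatten

/-- On the stream of rows of any `Z ∈ ℝ^{k × m}`, each of which it reads exactly once, the program
`p` outputs the stream of rows of `B * Z`, and it makes at most `T` steps in total. -/
def StreamProg.Multiplies {s n k : ℕ} (p : StreamProg s) (B : Matrix (Fin n) (Fin k) ℝ) (m : ℕ)
    (T : ℝ) : Prop :=
  ∀ Z : Matrix (Fin k) (Fin m) ℝ, ∃ c : StreamConfig s,
    p.exec (StreamConfig.init s (rowStream Z)) = some c ∧
      c.inp = [] ∧ c.out = rowStream (B * Z) ∧ (c.time : ℝ) ≤ T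

/-! ### Discrete Fourier analysis: Parseval and a finite Hilbert inequality -/

section Fourier

open Complex Finset

/-! Lower bound on `Opt`. The kernel 1/sin(π(i-j+1/2)/n) is, up to a factor i, a sum of n characters
at half-integer angles, so by Parseval its bilinear form has norm at most n (`hilbert_inequality`).
Pairing it with BC, one inner index at a time, gives at most n² · MaxErr (`sum_div_sin_le_maxErr`).
On the prefix sum matrix only positive entries of the kernel survive, and sin t ≤ t turns them into
harmonic sums of total at least n²(log n - 1)/π.

Upper bound on `Opt`. The Toeplitz matrix with symbol (1-x)^(-1/2) squares to the prefix sum matrix.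
By Wallis, its k-th coefficient f_k satisfies f_k² ≤ 1/(πk) for k ≥ 1, so the sum of the first n
squares is at most log n/π + 2.

A small linear system. For k < N, f_k is an average of powers x^k with x in [0,1]
(`sqrtCoeff_eq_average`). Expanding each power around one of O(log N) dyadic centres τ leaves a
Taylor tail of order 3^(-q) (`exists_sqrtCoeff_approx`), so q = O(log N) terms approximate f within
N^(-3) up to a constant. The sequences choose(k,r) τ^(k-r) that occur are the impulse responses of a
chain of registers, so O(log² N) registers in all realise an approximation b. The exact cofactor c,
with symbol 1/((1-x)b(x)), is then also close to f (`exists_cofactor`), and both factors keep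
squared norm log N/π + O(1) (`exists_fast_toeplitz`).

The tree. With N = min(n, n₁), the indices are the leaves of an N-ary tree with about log n/log N
levels. A prefix splits, at each level, into the complete earlier siblings of the current node; the
sums over children are factored by the Toeplitz pair of size at most N (`tree_factorization`). The
squared norms add up over the levels to log n/π + O(log n/log N) + O(log N), whence the relative
error O(1/log n₁) and the additive error O(log n₁).

The stream. Columns of the left factor come in postorder, so one nested loop per level suffices:
before a child, compute the contribution of its earlier siblings from the state of the linear
system; after it, feed the child's own row into the state (`bodySpec_nodeProg`). There are O(n)
nodes at cost O(m log² N) each, and O(log n/log N) levels with O(m log² N) registers each. -/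

/-- The character sum over equidistributed angles. -/
theorem sum_exp_angle (M : ℕ) (hM : 0 < M) (s : ℝ) (a b : ℕ) (ha : a < M) (hb : b < M) :
    ∑ t ∈ range M, exp (I * (a : ℂ) * (2 * Real.pi * (t + s) / M : ℝ)) *
      exp (-(I * (b : ℂ) * (2 * Real.pi * (t + s) / M : ℝ))) = if a = b then (M : ℂ) else 0 := by
  have hM' : (M : ℂ) ≠ 0 := by exact_mod_cast hM.ne'
  split_ifs with h
  · subst h
    simp [← exp_add]
  · set r : ℂ := exp (2 * Real.pi * I * ((a - b : ℤ) / (M : ℂ))) with hr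
    have hterm : ∀ t ∈ range M, exp (I * (a : ℂ) * (2 * Real.pi * (t + s) / M : ℝ)) *
        exp (-(I * (b : ℂ) * (2 * Real.pi * (t + s) / M : ℝ))) =
        exp (2 * Real.pi * I * ((a - b : ℤ) / (M : ℂ)) * s) * r ^ t := by
      intro t _
      rw [hr, ← exp_nat_mul, ← exp_add, ← exp_add]
      congr 1
      push_cast
      field_simp
      ring
    rw [sum_congr rfl hterm, ← mul_sum]
    have hr1 : r ≠ 1 := by
      intro h1
      rw [hr, exp_eq_one_iff] at h1
      obtain ⟨k, hk⟩ := h1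
      have h2 : ((a - b : ℤ) : ℂ) = ((k * M : ℤ) : ℂ) := by
        have hpi : (2 * Real.pi * I : ℂ) ≠ 0 := two_pi_I_ne_zero
        have : ((a - b : ℤ) / (M : ℂ)) = k :=
          mul_left_cancel₀ hpi (by rw [hk]; ring)
        rw [div_eq_iff hM'] at this
        rw [this]; push_cast; ring
      have h3 : (a - b : ℤ) = k * M := by exact_mod_cast h2
      have : (a - b : ℤ) = 0 :=
        Int.eq_zero_of_abs_lt_dvd (Dvd.intro_left k h3.symm)
          (by rw [abs_lt]; constructor <;> omega)
      omega
    have hrM : r ^ M = 1 := by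
      rw [hr, ← exp_nat_mul, exp_eq_one_iff]
      exact ⟨a - b, by push_cast; field_simp⟩
    rw [geom_sum_eq hr1, hrM]
    simp

/-- Parseval's identity for equidistributed angles. -/
theorem sum_norm_sq_trigPoly (M : ℕ) (hM : 0 < M) (s : ℝ) (u : ℕ → ℝ) :
    ∑ t ∈ range M, ‖∑ a ∈ range M, (u a : ℂ) *
        exp (I * (a : ℂ) * (2 * Real.pi * (t + s) / M : ℝ))‖ ^ 2 =
      M * ∑ a ∈ range M, u a ^ 2 := by
  have key : ((∑ t ∈ range M, ‖∑ a ∈ range M, (u a : ℂ) *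
      exp (I * (a : ℂ) * (2 * Real.pi * (t + s) / M : ℝ))‖ ^ 2 : ℝ) : ℂ) =
      ((M * ∑ a ∈ range M, u a ^ 2 : ℝ) : ℂ) := by
    have h1 : ∀ t ∈ range M, ((‖∑ a ∈ range M, (u a : ℂ) *
        exp (I * (a : ℂ) * (2 * Real.pi * (t + s) / M : ℝ))‖ ^ 2 : ℝ) : ℂ) =
        ∑ a ∈ range M, ∑ b ∈ range M, (u a : ℂ) * (u b : ℂ) *
          (exp (I * (a : ℂ) * (2 * Real.pi * (t + s) / M : ℝ)) *
            exp (-(I * (b : ℂ) * (2 * Real.pi * (t + s) / M : ℝ)))) := by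
      intro t _
      push_cast
      rw [← Complex.mul_conj', map_sum, sum_mul_sum]
      refine sum_congr rfl fun a _ => sum_congr rfl fun b _ => ?_
      rw [map_mul, conj_ofReal, ← exp_conj]
      simp only [map_mul, conj_I, conj_ofReal, map_natCast, map_div₀, map_add, map_ofNat]
      have : (-I * (b : ℂ) * (2 * Real.pi * (t + s) / M)) =
        -(I * (b : ℂ) * (2 * Real.pi * (t + s) / M)) := by ring
      rw [this]; ring
    rw [ofReal_sum, sum_congr rfl h1, sum_comm]
    have h2 : ∀ a ∈ range M, ∑ t ∈ range M, ∑ b ∈ range M, (u a : ℂ) * (u b : ℂ) *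
          (exp (I * (a : ℂ) * (2 * Real.pi * (t + s) / M : ℝ)) *
            exp (-(I * (b : ℂ) * (2 * Real.pi * (t + s) / M : ℝ)))) = M * (u a : ℂ) ^ 2 := by
      intro a ha
      rw [sum_comm]
      have : ∀ b ∈ range M, ∑ t ∈ range M, (u a : ℂ) * (u b : ℂ) *
          (exp (I * (a : ℂ) * (2 * Real.pi * (t + s) / M : ℝ)) *
            exp (-(I * (b : ℂ) * (2 * Real.pi * (t + s) / M : ℝ)))) =
          if a = b then (u a : ℂ) * (u b : ℂ) * M else 0 := by
        intro b hb
        rw [← mul_sum, sum_exp_angle M hM s a b (mem_range.1 ha) (mem_range.1 hb)]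
        split_ifs <;> simp
      rw [sum_congr rfl this, sum_ite_eq, if_pos ha]
      ring
    rw [sum_congr rfl h2, ← mul_sum]
    push_cast
    rfl
  exact_mod_cast key

/-- The character sums at half-integer frequencies over half-integer angles. -/
theorem sum_exp_half_angle (n : ℕ) (i j : ℕ) (hj : j < n) :
    ∑ t ∈ range n, exp (I * ((i : ℂ) - j + 1 / 2) * (2 * Real.pi * (t + 1 / 2) / n : ℝ)) =
      I * ((1 / Real.sin (Real.pi * (i - j + 1 / 2) / n) : ℝ) : ℂ) := by
  have hn : (n : ℂ) ≠ 0 := by exact_mod_cast (by omega : n ≠ 0)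
  set x : ℂ := Real.pi * ((i : ℂ) - j + 1 / 2) / n with hx
  have hsin : sin x ≠ 0 := by
    intro h
    rw [Complex.sin_eq_zero_iff] at h
    obtain ⟨k, hk⟩ := h
    have hpi : (Real.pi : ℂ) ≠ 0 := by exact_mod_cast Real.pi_ne_zero
    -- A zero of the sine would make an odd integer even.
    have h1 : ((2 * (i - j) + 1 : ℤ) : ℂ) = ((2 * (k * n) : ℤ) : ℂ) := by
      have : (Real.pi : ℂ) * ((i : ℂ) - j + 1 / 2) = Real.pi * (k * n) := by
        rw [hx] at hk
        field_simp at hk ⊢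
        linear_combination hk
      have := mul_left_cancel₀ hpi this
      push_cast
      linear_combination 2 * this
    have h2 : (2 * (i - j) + 1 : ℤ) = 2 * (k * n) := by exact_mod_cast h1
    omega
  have hterm : ∀ t ∈ range n,
      exp (I * ((i : ℂ) - j + 1 / 2) * (2 * Real.pi * (t + 1 / 2) / n : ℝ)) =
        exp (x * I) * exp (2 * (x * I)) ^ t := by
    intro t _
    rw [← exp_nat_mul, ← exp_add]
    congr 1
    rw [hx]; push_cast; field_simp; ring
  have hne : exp (2 * (x * I)) ≠ 1 := by
    intro h
    apply hsin
    rw [Complex.sin]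
    have h2 : exp (x * I) = exp (-x * I) := by
      have : exp (x * I) * exp (x * I) = exp (-x * I) * exp (x * I) := by
        rw [← exp_add, ← exp_add, ← two_mul, h]; simp
      exact mul_right_cancel₀ (exp_ne_zero _) this
    rw [h2]; simp
  -- The half-integer frequency makes the n-th power -1 instead of 1, so the geometric sum does not
  -- vanish: it equals e^(ix) · (-2)/(e^(2ix) - 1) = i/sin x.
  have hpow : exp (2 * (x * I)) ^ n = -1 := by
    rw [← exp_nat_mul]
    have : (n : ℂ) * (2 * (x * I)) = Real.pi * I + (i - j : ℤ) * (2 * Real.pi * I) := by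
      rw [hx]; push_cast; field_simp; ring
    rw [this, exp_add, exp_int_mul_two_pi_mul_I, exp_pi_mul_I]; simp
  rw [sum_congr rfl hterm, ← mul_sum, geom_sum_eq hne, hpow]
  have hcast : ((1 / Real.sin (Real.pi * (i - j + 1 / 2) / n) : ℝ) : ℂ) = 1 / sin x := by
    rw [hx]; push_cast; rfl
  rw [hcast]
  have hs : exp (x * I) * sin x * 2 * I = exp (2 * (x * I)) - 1 := by
    rw [Complex.sin]
    have : exp (x * I) * exp (-x * I) = 1 := by rw [← exp_add]; simp
    have h3 : exp (2 * (x * I)) = exp (x * I) * exp (x * I) := by rw [← exp_add, two_mul]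
    rw [h3]
    linear_combination (exp (x * I) * exp (-x * I) - exp (x * I) * exp (x * I)) * I_sq - this
  have hd : exp (2 * (x * I)) - 1 ≠ 0 := sub_ne_zero.2 hne
  rw [mul_div_assoc', div_eq_iff hd, ← hs]
  field_simp
  linear_combination (-2) * I_sq

/-- A finite Hilbert inequality. -/
theorem hilbert_inequality (n : ℕ) (u v : ℕ → ℝ) :
    ∑ i ∈ range n, ∑ j ∈ range n, u i * v j / Real.sin (Real.pi * (i - j + 1 / 2) / n) ≤
      n * (√(∑ i ∈ range n, u i ^ 2) * √(∑ i ∈ range n, v i ^ 2)) := by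
  rcases Nat.eq_zero_or_pos n with rfl | hn
  · simp
  set θ : ℕ → ℝ := fun t => 2 * Real.pi * (t + (1 / 2 : ℝ)) / n with hθ
  set U : ℕ → ℂ := fun t => ∑ a ∈ range n, (u a : ℂ) * exp (I * (a : ℂ) * (θ t : ℝ)) with hU
  set V : ℕ → ℂ := fun t => ∑ a ∈ range n, (v a : ℂ) * exp (I * (a : ℂ) * (θ t : ℝ)) with hV
  have hPU := sum_norm_sq_trigPoly n hn (1 / 2) u
  have hPV := sum_norm_sq_trigPoly n hn (1 / 2) v
  have hsum : ∑ t ∈ range n, exp (I * (1 / 2) * (θ t : ℝ)) * (U t * (starRingEnd ℂ) (V t)) =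
      I * ((∑ i ∈ range n, ∑ j ∈ range n,
        u i * v j / Real.sin (Real.pi * (i - j + 1 / 2) / n) : ℝ) : ℂ) := by
    have h1 : ∀ t ∈ range n, exp (I * (1 / 2) * (θ t : ℝ)) * (U t * (starRingEnd ℂ) (V t)) =
        ∑ i ∈ range n, ∑ j ∈ range n, (u i : ℂ) * v j *
          exp (I * ((i : ℂ) - j + 1 / 2) * (θ t : ℝ)) := by
      intro t _
      rw [hU, hV]
      simp only [map_sum]
      rw [sum_mul_sum, mul_sum]
      refine sum_congr rfl fun i _ => ?_
      rw [mul_sum]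
      refine sum_congr rfl fun j _ => ?_
      rw [map_mul, conj_ofReal, ← exp_conj]
      simp only [map_mul, conj_I, conj_ofReal, map_natCast]
      have : exp (I * ((i : ℂ) - j + 1 / 2) * (θ t : ℝ)) = exp (I * (1 / 2) * (θ t : ℝ)) *
          (exp (I * (i : ℂ) * (θ t : ℝ)) * exp (-I * (j : ℂ) * (θ t : ℝ))) := by
        rw [← exp_add, ← exp_add]; congr 1; ring
      rw [this]; ring
    rw [sum_congr rfl h1, sum_comm, ofReal_sum, mul_sum]
    refine sum_congr rfl fun i _ => ?_
    rw [sum_comm, ofReal_sum, mul_sum]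
    refine sum_congr rfl fun j hj => ?_
    rw [← mul_sum, sum_exp_half_angle n i j (mem_range.1 hj)]
    push_cast
    ring
  calc _ ≤ ‖I * ((∑ i ∈ range n, ∑ j ∈ range n,
        u i * v j / Real.sin (Real.pi * (i - j + 1 / 2) / n) : ℝ) : ℂ)‖ := by
        rw [norm_mul, norm_I, one_mul, norm_real]; exact le_abs_self _
    _ ≤ ∑ t ∈ range n, ‖U t‖ * ‖V t‖ := by
        rw [← hsum]
        refine (norm_sum_le _ _).trans (sum_le_sum fun t _ => ?_)
        have : I * (1 / 2) * (θ t : ℝ) = ((θ t / 2 : ℝ) : ℂ) * I := by push_cast; ring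
        rw [norm_mul, this, norm_exp_ofReal_mul_I, one_mul, norm_mul, RCLike.norm_conj]
    _ ≤ √(∑ t ∈ range n, ‖U t‖ ^ 2) * √(∑ t ∈ range n, ‖V t‖ ^ 2) :=
        Real.sum_mul_le_sqrt_mul_sqrt _ _ _
    _ = _ := by
        rw [hPU, hPV, Real.sqrt_mul (by positivity), Real.sqrt_mul (by positivity)]
        have := Real.mul_self_sqrt (Nat.cast_nonneg (α := ℝ) n)
        linear_combination (√(∑ i ∈ range n, u i ^ 2) * √(∑ i ∈ range n, v i ^ 2)) * this

end Fourier

/-! ### The lower bound for every factorization -/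

section LowerBound

open Finset

theorem row_sum_sq_le_iSup {n k : ℕ} (B : Matrix (Fin n) (Fin k) ℝ) (i : Fin n) :
    ∑ j : Fin k, B i j ^ 2 ≤ ⨆ i : Fin n, ∑ j : Fin k, B i j ^ 2 :=
  le_ciSup (f := fun i : Fin n => ∑ j : Fin k, B i j ^ 2) (Set.finite_range _).bddAbove i

theorem col_sum_sq_le_iSup {n k : ℕ} (C : Matrix (Fin k) (Fin n) ℝ) (j : Fin n) :
    ∑ i : Fin k, C i j ^ 2 ≤ ⨆ j : Fin n, ∑ i : Fin k, C i j ^ 2 :=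
  le_ciSup (f := fun j : Fin n => ∑ i : Fin k, C i j ^ 2) (Set.finite_range _).bddAbove j

/-- The Hilbert inequality with `Fin`-indexed vectors. -/
theorem hilbert_inequality_fin (n : ℕ) (u v : Fin n → ℝ) :
    ∑ i, ∑ j, u i * v j / Real.sin (Real.pi * ((i : ℕ) - (j : ℕ) + 1 / 2) / n) ≤
      n * (√(∑ i, u i ^ 2) * √(∑ i, v i ^ 2)) := by
  have h := hilbert_inequality n (fun i => if h : i < n then u ⟨i, h⟩ else 0)
    (fun i => if h : i < n then v ⟨i, h⟩ else 0)
  simpa [Finset.sum_range] using h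

/-- Duality for the factorization norm: BC is a sum of rank-one matrices, to each of which the
Hilbert inequality applies. Cauchy–Schwarz over the inner index then leaves the product of the
Frobenius norms, and a Frobenius norm is at most √n times the largest row (or column) norm. -/
theorem sum_div_sin_le_maxErr {n k : ℕ} (B : Matrix (Fin n) (Fin k) ℝ)
    (C : Matrix (Fin k) (Fin n) ℝ) :
    ∑ i, ∑ j, (B * C) i j / Real.sin (Real.pi * ((i : ℕ) - (j : ℕ) + 1 / 2) / n) ≤
      n * (n * MaxErr B C) := by
  set R := ⨆ i : Fin n, ∑ j : Fin k, B i j ^ 2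
  set S := ⨆ j : Fin n, ∑ i : Fin k, C i j ^ 2
  have hB : ∑ l, ∑ i, B i l ^ 2 ≤ n * R := by
    rw [sum_comm]
    calc _ ≤ ∑ i : Fin n, R := sum_le_sum fun i _ => row_sum_sq_le_iSup B i
      _ = _ := by simp
  have hC : ∑ l, ∑ j, C l j ^ 2 ≤ n * S := by
    rw [sum_comm]
    calc _ ≤ ∑ i : Fin n, S := sum_le_sum fun i _ => col_sum_sq_le_iSup C i
      _ = _ := by simp
  calc _ = ∑ l, ∑ i, ∑ j, B i l * C l j /
        Real.sin (Real.pi * ((i : ℕ) - (j : ℕ) + 1 / 2) / n) := by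
        simp_rw [Matrix.mul_apply, sum_div]
        rw [sum_comm (s := (univ : Finset (Fin k)))]
        exact sum_congr rfl fun i _ => sum_comm
    _ ≤ ∑ l, n * (√(∑ i, B i l ^ 2) * √(∑ j, C l j ^ 2)) :=
        sum_le_sum fun l _ => hilbert_inequality_fin n (fun i => B i l) (fun j => C l j)
    _ ≤ n * (√(∑ l, (√(∑ i, B i l ^ 2)) ^ 2) * √(∑ l, (√(∑ j, C l j ^ 2)) ^ 2)) := by
        rw [← mul_sum]
        exact mul_le_mul_of_nonneg_left (Real.sum_mul_le_sqrt_mul_sqrt univ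
          (fun l => √(∑ i, B i l ^ 2)) (fun l => √(∑ j, C l j ^ 2))) (by positivity)
    _ = n * (√(∑ l, ∑ i, B i l ^ 2) * √(∑ l, ∑ j, C l j ^ 2)) := by
        congr 4 <;> exact funext fun l => Real.sq_sqrt (sum_nonneg fun _ _ => sq_nonneg _)
    _ ≤ n * (√(n * R) * √(n * S)) := by gcongr
    _ = _ := by
        rw [Real.sqrt_mul (by positivity), Real.sqrt_mul (by positivity), MaxErr]
        have := Real.mul_self_sqrt (Nat.cast_nonneg (α := ℝ) n)
        linear_combination (n * √R * √S) * this

/-- Read backwards, the terms are 1/(j+1/2) ≥ 1/(j+1), so the sum dominates a harmonic number. -/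
theorem log_le_sum_inv_sub_add_half (i : ℕ) :
    Real.log (i + 1) ≤ ∑ j ∈ range (i + 1), 1 / ((i : ℝ) - j + 1 / 2) := by
  have h1 := log_add_one_le_harmonic (i + 1)
  have h2 : Real.log (i + 1) ≤ Real.log ((i + 1 + 1 : ℕ) : ℝ) := by
    apply Real.log_le_log (by positivity)
    push_cast; linarith
  refine h2.trans (h1.trans ?_)
  rw [← sum_range_reflect, harmonic]
  push_cast
  refine sum_le_sum fun j hj => ?_
  have hj' : j ≤ i := Nat.lt_succ_iff.1 (mem_range.1 hj)
  have : ((i - j : ℕ) : ℝ) = i - j := Nat.cast_sub hj'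
  rw [this, one_div]
  apply inv_anti₀ <;> linarith [Nat.cast_nonneg (α := ℝ) j]

/-- The weak form n^n/n! ≤ e^n of Stirling's formula. -/
theorem mul_log_sub_le_sum_log (n : ℕ) :
    n * (Real.log n - 1) ≤ ∑ i ∈ range n, Real.log (i + 1) := by
  rcases Nat.eq_zero_or_pos n with rfl | hn
  · simp
  have h1 : ∑ i ∈ range n, Real.log ((i : ℝ) + 1) = Real.log (n.factorial) := by
    rw [← prod_range_add_one_eq_factorial]
    push_cast
    rw [Real.log_prod]
    intro i _
    positivity
  have hn' : (0 : ℝ) < n := by exact_mod_cast hn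
  have h2 := Real.pow_div_factorial_le_exp (n : ℝ) (Nat.cast_nonneg n) n
  have h3 := Real.log_le_log (by positivity) h2
  rw [Real.log_exp, Real.log_div (by positivity) (by positivity), Real.log_pow] at h3
  rw [h1]; linarith

/-- Every factorization of the prefix sum matrix has error at least `(log n - 1) / π`. -/
theorem log_sub_one_div_pi_le_maxErr {n k : ℕ} (hn : 1 ≤ n) (B : Matrix (Fin n) (Fin k) ℝ)
    (C : Matrix (Fin k) (Fin n) ℝ) (h : B * C = prefixSumMatrix n) :
    (Real.log n - 1) / Real.pi ≤ MaxErr B C := by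
  have hn' : (0 : ℝ) < n := by exact_mod_cast hn
  have h1 := sum_div_sin_le_maxErr B C
  rw [h] at h1
  have h2 : n * (n * ((Real.log n - 1) / Real.pi)) ≤
      ∑ i, ∑ j, prefixSumMatrix n i j /
        Real.sin (Real.pi * ((i : ℕ) - (j : ℕ) + 1 / 2) / n) := by
    have h3 : ∀ i : Fin n, n / Real.pi * Real.log ((i : ℕ) + 1) ≤ ∑ j, prefixSumMatrix n i j /
        Real.sin (Real.pi * ((i : ℕ) - (j : ℕ) + 1 / 2) / n) := by
      intro i
      have h4 := log_le_sum_inv_sub_add_half i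
      have h5 : ∑ j : Fin n, (if j ≤ i then n / Real.pi * (1 / (((i : ℕ) : ℝ) - (j : ℕ) + 1 / 2))
          else 0) = n / Real.pi *
            ∑ j ∈ range ((i : ℕ) + 1), 1 / (((i : ℕ) : ℝ) - j + 1 / 2) := by
        rw [mul_sum]
        have : range ((i : ℕ) + 1) = (range n).filter (fun j => j ≤ (i : ℕ)) := by
          ext j; simp; omega
        rw [this, sum_filter, Finset.sum_range]
        rfl
      refine (mul_le_mul_of_nonneg_left h4 (by positivity)).trans ?_
      rw [← h5]
      refine sum_le_sum fun j _ => ?_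
      simp only [prefixSumMatrix, Matrix.of_apply]
      split_ifs with hji
      · have hji' : ((j : ℕ) : ℝ) ≤ (i : ℕ) := by exact_mod_cast hji
        have hin : ((i : ℕ) : ℝ) + 1 ≤ n := by exact_mod_cast i.2
        have hj0 : (0 : ℝ) ≤ (j : ℕ) := by positivity
        have hd : (0 : ℝ) < ((i : ℕ) : ℝ) - (j : ℕ) + 1 / 2 := by linarith
        have hpos : 0 < Real.pi * (((i : ℕ) : ℝ) - (j : ℕ) + 1 / 2) / n := by positivity
        have hlt : Real.pi * (((i : ℕ) : ℝ) - (j : ℕ) + 1 / 2) / n < Real.pi := by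
          rw [div_lt_iff₀ hn']
          apply mul_lt_mul_of_pos_left _ Real.pi_pos
          linarith
        have hs := Real.sin_pos_of_pos_of_lt_pi hpos hlt
        have hle := Real.sin_le hpos.le
        have := one_div_le_one_div_of_le hs hle
        refine le_trans (le_of_eq ?_) this
        field_simp
      · simp
    calc _ = n / Real.pi * (n * (Real.log n - 1)) := by ring
      _ ≤ n / Real.pi * ∑ i ∈ range n, Real.log ((i : ℝ) + 1) :=
          mul_le_mul_of_nonneg_left (mul_log_sub_le_sum_log n) (by positivity)
      _ = ∑ i : Fin n, n / Real.pi * Real.log ((i : ℕ) + 1) := by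
          rw [mul_sum, Finset.sum_range]
      _ ≤ _ := sum_le_sum fun i _ => h3 i
  have h6 := le_of_mul_le_mul_left (h2.trans h1) hn'
  exact le_of_mul_le_mul_left h6 hn'

end LowerBound

/-! ### The coefficients of (1-x)^(-1/2) -/

section SqrtCoeff

open Finset

/-- The coefficients of the power series of `(1 - x) ^ (-1/2)`. -/
noncomputable def sqrtCoeff (k : ℕ) : ℝ := (Nat.centralBinom k : ℝ) / 4 ^ k

theorem sqrtCoeff_zero : sqrtCoeff 0 = 1 := by simp [sqrtCoeff]

theorem sqrtCoeff_pos (k : ℕ) : 0 < sqrtCoeff k := by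
  have := Nat.centralBinom_pos k
  rw [sqrtCoeff]; positivity

theorem sqrtCoeff_succ (k : ℕ) :
    2 * ((k : ℝ) + 1) * sqrtCoeff (k + 1) = (2 * k + 1) * sqrtCoeff k := by
  have h : ((k : ℝ) + 1) * Nat.centralBinom (k + 1) = 2 * (2 * k + 1) * Nat.centralBinom k := by
    exact_mod_cast Nat.succ_mul_centralBinom_succ k
  rw [sqrtCoeff, sqrtCoeff, pow_succ]
  field_simp
  linear_combination 2 * h

theorem sqrtCoeff_le_one (k : ℕ) : sqrtCoeff k ≤ 1 := by
  rw [sqrtCoeff, div_le_one (by positivity)]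
  exact_mod_cast Nat.centralBinom_le_four_pow k

/-- The square of the power series is `1 / (1 - x)`. -/
theorem sum_antidiagonal_sqrtCoeff (k : ℕ) :
    ∑ p ∈ antidiagonal k, sqrtCoeff p.1 * sqrtCoeff p.2 = 1 := by
  induction k with
  | zero => simp [sqrtCoeff_zero]
  | succ k ih =>
    have hswap : ∀ m : ℕ, ∀ g : ℕ × ℕ → ℝ,
        ∑ p ∈ antidiagonal m, g p = ∑ p ∈ antidiagonal m, g p.swap := fun m g =>
      (Finset.Nat.sum_antidiagonal_swap (n := m) (f := g)).symm
    -- The differential equation 2(1-x)f' = f in coefficients. By symmetry the weight p.1 + p.2 may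
    -- be replaced by 2 p.1; the recursion lowers the index, and symmetrising back shows that (k+1)
    -- times the sum is the same for k+1 as for k.
    have h1 : ((k : ℝ) + 1) * ∑ p ∈ antidiagonal (k + 1), sqrtCoeff p.1 * sqrtCoeff p.2 =
        2 * ∑ p ∈ antidiagonal (k + 1), (p.1 : ℝ) * (sqrtCoeff p.1 * sqrtCoeff p.2) := by
      have h2 : ((k : ℝ) + 1) * ∑ p ∈ antidiagonal (k + 1), sqrtCoeff p.1 * sqrtCoeff p.2 =
          ∑ p ∈ antidiagonal (k + 1), (p.1 : ℝ) * (sqrtCoeff p.1 * sqrtCoeff p.2) +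
          ∑ p ∈ antidiagonal (k + 1), (p.2 : ℝ) * (sqrtCoeff p.1 * sqrtCoeff p.2) := by
        rw [mul_sum, ← sum_add_distrib]
        refine sum_congr rfl fun p hp => ?_
        have : ((p.1 + p.2 : ℕ) : ℝ) = (k + 1 : ℕ) := by rw [mem_antidiagonal.1 hp]
        push_cast at this
        rw [← this]; ring
      rw [h2, hswap (k + 1) (fun p => (p.2 : ℝ) * (sqrtCoeff p.1 * sqrtCoeff p.2)), two_mul]
      congr 1
      refine sum_congr rfl fun p _ => ?_
      simp only [Prod.fst_swap, Prod.snd_swap]; ring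
    have h3 : 2 * ∑ p ∈ antidiagonal (k + 1), (p.1 : ℝ) * (sqrtCoeff p.1 * sqrtCoeff p.2) =
        ∑ p ∈ antidiagonal k, (2 * (p.1 : ℝ) + 1) * (sqrtCoeff p.1 * sqrtCoeff p.2) := by
      rw [Finset.Nat.sum_antidiagonal_succ, mul_add, mul_sum]
      simp only [Nat.cast_zero, zero_mul, mul_zero, zero_add]
      refine sum_congr rfl fun p _ => ?_
      push_cast
      linear_combination sqrtCoeff p.2 * sqrtCoeff_succ p.1
    have h4 : 2 * ∑ p ∈ antidiagonal k, (2 * (p.1 : ℝ) + 1) * (sqrtCoeff p.1 * sqrtCoeff p.2) =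
        2 * ((k : ℝ) + 1) * ∑ p ∈ antidiagonal k, sqrtCoeff p.1 * sqrtCoeff p.2 := by
      nth_rw 1 [two_mul]
      nth_rw 1 [hswap k (fun p => (2 * (p.1 : ℝ) + 1) * (sqrtCoeff p.1 * sqrtCoeff p.2))]
      rw [← sum_add_distrib, mul_sum]
      refine sum_congr rfl fun p hp => ?_
      have : ((p.1 + p.2 : ℕ) : ℝ) = (k : ℕ) := by rw [mem_antidiagonal.1 hp]
      push_cast at this
      rw [← this]
      simp only [Prod.fst_swap, Prod.snd_swap]; ring
    rw [ih] at h4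
    have hk : ((k : ℝ) + 1) ≠ 0 := by positivity
    apply mul_left_cancel₀ hk
    linarith

/-- The squared coefficients are reciprocal Wallis products up to the factor 2k+1; this is where π
enters the upper bound. -/
theorem W_mul_sqrtCoeff_sq (k : ℕ) : Real.Wallis.W k * (sqrtCoeff k ^ 2 * (2 * k + 1)) = 1 := by
  induction k with
  | zero => simp [Real.Wallis.W, sqrtCoeff_zero]
  | succ k ih =>
    have h : sqrtCoeff (k + 1) = (2 * k + 1) * sqrtCoeff k / (2 * (k + 1)) := by
      rw [eq_div_iff (by positivity), ← sqrtCoeff_succ]; ring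
    rw [Real.Wallis.W_succ, h]
    push_cast
    field_simp
    linear_combination (2 * (k : ℝ) + 3) * ih

theorem sqrtCoeff_succ_sq_le (k : ℕ) :
    sqrtCoeff (k + 1) ^ 2 ≤ 1 / Real.pi * ((k : ℝ) + 1)⁻¹ := by
  have h1 := W_mul_sqrtCoeff_sq (k + 1)
  have h2 := Real.Wallis.le_W (k + 1)
  have hf := sq_nonneg (sqrtCoeff (k + 1))
  have h3 : (2 * ((k + 1 : ℕ) : ℝ) + 1) / (2 * ((k + 1 : ℕ) : ℝ) + 2) * (Real.pi / 2) *
      (sqrtCoeff (k + 1) ^ 2 * (2 * ((k + 1 : ℕ) : ℝ) + 1)) ≤ 1 :=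
    (mul_le_mul_of_nonneg_right h2 (by positivity)).trans h1.le
  have hk : (0 : ℝ) ≤ k := Nat.cast_nonneg k
  have hpi := Real.pi_pos
  push_cast at h3
  have h4 : Real.pi * ((k : ℝ) + 1) ≤
      (2 * ((k : ℝ) + 1) + 1) / (2 * ((k : ℝ) + 1) + 2) * (Real.pi / 2) *
      (2 * ((k : ℝ) + 1) + 1) := by
    rw [div_mul_div_comm, div_mul_eq_mul_div, le_div_iff₀ (by positivity)]
    nlinarith
  have h5 : sqrtCoeff (k + 1) ^ 2 * (Real.pi * ((k : ℝ) + 1)) ≤ 1 := by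
    refine (mul_le_mul_of_nonneg_left h4 hf).trans (le_trans (le_of_eq ?_) h3)
    ring
  rw [one_div, ← mul_inv, ← one_div, le_div_iff₀ (by positivity)]
  exact h5

theorem sum_sqrtCoeff_sq_le (n : ℕ) :
    ∑ k ∈ range n, sqrtCoeff k ^ 2 ≤ Real.log n / Real.pi + 2 := by
  rcases n with _ | n
  · simp
  rw [sum_range_succ', sqrtCoeff_zero]
  have h1 : ∑ k ∈ range n, sqrtCoeff (k + 1) ^ 2 ≤ 1 / Real.pi * (harmonic n : ℝ) := by
    rw [harmonic, Rat.cast_sum, mul_sum]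
    refine sum_le_sum fun k _ => ?_
    push_cast
    exact sqrtCoeff_succ_sq_le k
  have h2 := harmonic_le_one_add_log n
  have h3 : Real.log n ≤ Real.log (n + 1 : ℕ) := by
    rcases Nat.eq_zero_or_pos n with rfl | hn
    · simp
    · exact Real.log_le_log (by exact_mod_cast hn) (by push_cast; linarith)
  have hpi : 1 / Real.pi ≤ 1 := by
    rw [div_le_one Real.pi_pos]; linarith [Real.pi_gt_three]
  have h4 : 1 / Real.pi * (harmonic n : ℝ) ≤ 1 / Real.pi * (1 + Real.log (n + 1 : ℕ)) := by
    gcongr; linarith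
  have h5 : 1 / Real.pi * (1 + Real.log (n + 1 : ℕ)) =
    1 / Real.pi + Real.log (n + 1 : ℕ) / Real.pi := by ring
  linarith

/-- The coefficients are the moments of equidistributed points on the circle. -/
theorem sqrtCoeff_eq_average (N k : ℕ) (hk : k < N) :
    sqrtCoeff k = (1 / N : ℝ) * ∑ t ∈ range N,
      ((1 + Real.cos (2 * Real.pi * (t + 0) / N)) / 2) ^ k := by
  have hN : 0 < N := by omega
  have hP := sum_norm_sq_trigPoly N hN 0 (fun a => (Nat.choose k a : ℝ))
  -- The polynomial is (1+e^(iθ))^k, with squared modulus (2+2cos θ)^k. Parseval turns its average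
  -- into the sum of choose(k,a)², the central binomial coefficient; k < N guarantees that no
  -- coefficient is cut off.
  have h1 : ∀ t ∈ range N, ‖∑ a ∈ range N, (((k.choose a : ℕ) : ℝ) : ℂ) *
      Complex.exp (Complex.I * (a : ℂ) * (2 * Real.pi * (t + 0) / N : ℝ))‖ ^ 2 =
      4 ^ k * ((1 + Real.cos (2 * Real.pi * (t + 0) / N)) / 2) ^ k := by
    intro t _
    set θ : ℝ := 2 * Real.pi * (t + 0) / N
    have h2 : ∑ a ∈ range N, (((k.choose a : ℕ) : ℝ) : ℂ) *
        Complex.exp (Complex.I * (a : ℂ) * (θ : ℝ)) = (Complex.exp (θ * Complex.I) + 1) ^ k := by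
      rw [add_pow, ← sum_subset (range_subset_range.2 (by omega : k + 1 ≤ N))]
      · refine sum_congr rfl fun a _ => ?_
        rw [one_pow, ← Complex.exp_nat_mul, mul_one, mul_comm]
        congr 2
        · ring
      · intro a _ ha
        rw [mem_range, not_lt] at ha
        rw [Nat.choose_eq_zero_of_lt (by omega)]
        simp
    rw [h2, norm_pow, ← pow_mul, mul_comm k 2, pow_mul, ← mul_pow]
    congr 1
    rw [Complex.exp_mul_I, ← Complex.ofReal_cos, ← Complex.ofReal_sin, ← Complex.normSq_eq_norm_sq,
      Complex.normSq_apply]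
    simp only [Complex.add_re, Complex.add_im, Complex.mul_re, Complex.mul_im, Complex.ofReal_re,
      Complex.ofReal_im, Complex.I_re, Complex.I_im, Complex.one_re, Complex.one_im]
    linear_combination Real.sin_sq_add_cos_sq θ
  rw [sum_congr rfl h1, ← mul_sum] at hP
  have h3 : ∑ a ∈ range N, (Nat.choose k a : ℝ) ^ 2 = Nat.centralBinom k := by
    rw [← sum_subset (range_subset_range.2 (by omega : k + 1 ≤ N))]
    · rw [Nat.centralBinom_eq_two_mul_choose]
      exact_mod_cast Nat.sum_range_choose_sq k
    · intro a _ ha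
      rw [mem_range, not_lt] at ha
      rw [Nat.choose_eq_zero_of_lt (by omega)]
      simp
  rw [h3] at hP
  have hN' : (N : ℝ) ≠ 0 := by exact_mod_cast hN.ne'
  rw [sqrtCoeff]
  field_simp
  linear_combination -hP

end SqrtCoeff

/-! ### Products and norms of lower triangular Toeplitz matrices -/

section Toeplitz

open Finset

/-- The product of two lower triangular Toeplitz matrices whose symbols multiply
to `1 / (1 - x)`. -/
theorem sum_toeplitz_mul {N : ℕ} {b c : ℕ → ℝ}
    (hbc : ∀ k < N, ∑ p ∈ antidiagonal k, b p.1 * c p.2 = 1) {i j : ℕ} (hi : i < N) :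
    ∑ l ∈ range N, (if l ≤ i then b (i - l) else 0) * (if j ≤ l then c (l - j) else 0) =
      if j ≤ i then 1 else 0 := by
  have h1 : ∑ l ∈ range N, (if l ≤ i then b (i - l) else 0) * (if j ≤ l then c (l - j) else 0) =
      ∑ l ∈ Icc j i, b (i - l) * c (l - j) := by
    rw [← sum_subset (s₁ := Icc j i)]
    · refine sum_congr rfl fun l hl => ?_
      rw [mem_Icc] at hl
      rw [if_pos hl.2, if_pos hl.1]
    · intro l hl
      rw [mem_Icc] at hl
      exact mem_range.2 (by omega)
    · intro l _ hl
      rw [mem_Icc, not_and_or] at hl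
      rcases hl with hl | hl <;> simp [hl]
  rw [h1]
  split_ifs with hji
  · rw [← hbc (i - j) (by omega)]
    refine sum_bij' (fun l _ => (i - l, l - j)) (fun p _ => p.2 + j) ?_ ?_ ?_ ?_ ?_
    · intro l hl; rw [mem_Icc] at hl; rw [HasAntidiagonal.mem_antidiagonal]; omega
    · intro p hp; rw [HasAntidiagonal.mem_antidiagonal] at hp; rw [mem_Icc]; omega
    · intro l hl; rw [mem_Icc] at hl; omega
    · intro p hp; rw [HasAntidiagonal.mem_antidiagonal] at hp; ext <;> simp; omega
    · intro l _; rfl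
  · rw [Icc_eq_empty (by omega), sum_empty]

theorem sum_toeplitz_row_sq_le (N : ℕ) (b : ℕ → ℝ) {i : ℕ} (hi : i < N) :
    ∑ l ∈ range N, (if l ≤ i then b (i - l) else 0) ^ 2 ≤ ∑ k ∈ range N, b k ^ 2 := by
  have h1 : ∑ l ∈ range N, (if l ≤ i then b (i - l) else 0) ^ 2 =
      ∑ l ∈ range (i + 1), b (i - l) ^ 2 := by
    rw [← sum_subset (range_subset_range.2 (by omega : i + 1 ≤ N))]
    · refine sum_congr rfl fun l hl => ?_
      rw [if_pos (by rw [mem_range] at hl; omega)]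
    · intro l _ hl
      rw [if_neg (by rw [mem_range] at hl; omega)]; simp
  rw [h1, sum_flip (fun l => b l ^ 2)]
  exact sum_le_sum_of_subset_of_nonneg (range_subset_range.2 (by omega))
    fun _ _ _ => sq_nonneg _

theorem sum_toeplitz_col_sq_le (N : ℕ) (c : ℕ → ℝ) (j : ℕ) :
    ∑ l ∈ range N, (if j ≤ l then c (l - j) else 0) ^ 2 ≤ ∑ k ∈ range N, c k ^ 2 := by
  rcases le_or_gt j N with hj | hj
  · obtain ⟨d, rfl⟩ := Nat.exists_eq_add_of_le hj
    rw [sum_range_add]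
    have h1 : ∑ l ∈ range j, (if j ≤ l then c (l - j) else 0) ^ 2 = 0 :=
      sum_eq_zero fun l hl => by rw [if_neg (by rw [mem_range] at hl; omega)]; simp
    rw [h1, zero_add]
    simp only [Nat.le_add_right, if_true, Nat.add_sub_cancel_left]
    exact sum_le_sum_of_subset_of_nonneg (range_subset_range.2 (by omega))
      fun _ _ _ => sq_nonneg _
  · rw [sum_eq_zero]
    · exact sum_nonneg fun _ _ => sq_nonneg _
    · intro l hl; rw [if_neg (by rw [mem_range] at hl; omega)]; simp

end Toeplitz

/-! ### The value of `Opt` up to an additive constant -/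

section Opt

open Finset

theorem maxErr_nonneg {n k : ℕ} (B : Matrix (Fin n) (Fin k) ℝ) (C : Matrix (Fin k) (Fin n) ℝ) :
    0 ≤ MaxErr B C := by
  rw [MaxErr]; positivity

theorem maxErr_le {n k : ℕ} (hn : 0 < n) (B : Matrix (Fin n) (Fin k) ℝ)
    (C : Matrix (Fin k) (Fin n) ℝ) {x : ℝ} (hB : ∀ i, ∑ j, B i j ^ 2 ≤ x)
    (hC : ∀ j, ∑ i, C i j ^ 2 ≤ x) : MaxErr B C ≤ x := by
  have : Nonempty (Fin n) := ⟨⟨0, hn⟩⟩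
  have hx : 0 ≤ x := le_trans (sum_nonneg fun _ _ => sq_nonneg _) (hB ⟨0, hn⟩)
  rw [MaxErr]
  calc _ ≤ √x * √x := by gcongr <;> exact ciSup_le (by assumption)
    _ = x := Real.mul_self_sqrt hx

theorem opt_le_maxErr {n k : ℕ} (B : Matrix (Fin n) (Fin k) ℝ) (C : Matrix (Fin k) (Fin n) ℝ)
    (h : B * C = prefixSumMatrix n) : Opt n ≤ MaxErr B C := by
  refine csInf_le ⟨0, ?_⟩ ⟨k, B, C, h, rfl⟩
  rintro x ⟨k, B, C, -, rfl⟩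
  exact maxErr_nonneg B C

theorem opt_le (n : ℕ) (hn : 1 ≤ n) : Opt n ≤ Real.log n / Real.pi + 2 := by
  let F : Matrix (Fin n) (Fin n) ℝ :=
    Matrix.of fun i j => if (j : ℕ) ≤ (i : ℕ) then sqrtCoeff (i - j) else 0
  have hF : F * F = prefixSumMatrix n := by
    ext i j
    have := sum_toeplitz_mul (N := n) (fun k _ => sum_antidiagonal_sqrtCoeff k) (j := (j : ℕ)) i.2
    rw [Finset.sum_range] at this
    simpa only [Matrix.mul_apply, prefixSumMatrix, Matrix.of_apply, F, Fin.le_def] using this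
  refine (opt_le_maxErr F F hF).trans (maxErr_le hn F F (fun i => ?_) fun j => ?_)
  · refine le_trans ?_ (sum_sqrtCoeff_sq_le n)
    have := sum_toeplitz_row_sq_le n sqrtCoeff i.2
    rw [Finset.sum_range] at this
    exact this
  · refine le_trans ?_ (sum_sqrtCoeff_sq_le n)
    have := sum_toeplitz_col_sq_le n sqrtCoeff j
    rw [Finset.sum_range] at this
    exact this

theorem le_opt (n : ℕ) (hn : 1 ≤ n) : (Real.log n - 1) / Real.pi ≤ Opt n := by
  refine le_csInf ⟨_, n, prefixSumMatrix n, 1, by simp, rfl⟩ ?_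
  rintro x ⟨k, B, C, h, rfl⟩
  exact log_sub_one_div_pi_le_maxErr hn B C h

theorem abs_opt_sub_le (n : ℕ) (hn : 1 ≤ n) : |Opt n - Real.log n / Real.pi| ≤ 2 := by
  have h1 := opt_le n hn
  have h2 := le_opt n hn
  rw [sub_div] at h2
  have hpi : 1 / Real.pi ≤ 1 := by
    rw [div_le_one Real.pi_pos]; linarith [Real.pi_gt_three]
  rw [abs_le]
  constructor <;> linarith

end Opt

/-! ### Approximating the coefficients by polynomial-exponential sequences -/

section Taylor

open Finset

/-- It is a probability of the binomial distribution with parameters k and 1-τ. -/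
theorem choose_mul_pow_mul_pow_le_one {τ : ℝ} (h0 : 0 ≤ τ) (h1 : τ ≤ 1) (k r : ℕ) :
    (k.choose r : ℝ) * τ ^ (k - r) * (1 - τ) ^ r ≤ 1 := by
  rcases le_or_gt r k with hr | hr
  · have h := add_pow (1 - τ) τ k
    rw [sub_add_cancel, one_pow] at h
    refine le_trans (le_of_eq ?_) ((single_le_sum (f := fun m => (1 - τ) ^ m * τ ^ (k - m) *
      (k.choose m : ℝ)) (fun m _ => ?_) (mem_range.2 (by omega : r < k + 1))).trans_eq h.symm)
    · ring
    · have : 0 ≤ 1 - τ := by linarith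
      positivity
  · rw [Nat.choose_eq_zero_of_lt hr]; simp

/-- The centres of a dyadic partition of `[0, 1]` towards `1`. -/
noncomputable def dyadicCentre (P p : ℕ) : ℝ := if p < P then 1 - 3 / 4 * (1 / 2) ^ p else 1

theorem exists_dyadic_bracket {u : ℝ} (hu : u ≤ 1) (P : ℕ) (hP : (1 / 2) ^ P < u) :
    ∃ p < P, (1 / 2) ^ (p + 1) ≤ u ∧ u ≤ (1 / 2) ^ p := by
  induction P with
  | zero => simp at hP; linarith
  | succ P ih =>
    rcases lt_or_ge ((1 / 2) ^ P) u with h | h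
    · obtain ⟨p, hp, h1⟩ := ih h
      exact ⟨p, by omega, h1⟩
    · exact ⟨P, by omega, hP.le, h⟩

/-- In the dyadic interval 2^(-p-1) ≤ 1-x ≤ 2^(-p) the centre τ satisfies |x-τ| ≤ (1-τ)/3, and the
binomial probability bound does the rest. The remaining x, within 2^(-P) of 1, use the centre 1:
there choose(k,r) ≤ N^r and N(1-x) ≤ 1/3. -/
theorem exists_dyadicCentre {N P : ℕ} (hP : 3 * N ≤ 2 ^ P) {x : ℝ} (hx0 : 0 ≤ x) (hx1 : x ≤ 1) :
    ∃ p < P + 1, ∀ k < N, ∀ r, (k.choose r : ℝ) * dyadicCentre P p ^ (k - r) *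
      |x - dyadicCentre P p| ^ r ≤ (1 / 3) ^ r := by
  rcases le_or_gt (1 - x) ((1 / 2) ^ P) with h | h
  · refine ⟨P, by omega, fun k hk r => ?_⟩
    have hc : dyadicCentre P P = 1 := by simp [dyadicCentre]
    rw [hc, one_pow, mul_one, abs_sub_comm, abs_of_nonneg (by linarith)]
    have h1 : (k.choose r : ℝ) ≤ (N : ℝ) ^ r := by
      calc (k.choose r : ℝ) ≤ ((k ^ r : ℕ) : ℝ) := by exact_mod_cast Nat.choose_le_pow k r
        _ ≤ (N : ℝ) ^ r := by push_cast; gcongr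
    have h2 : (N : ℝ) * (1 - x) ≤ 1 / 3 := by
      have h3 : (3 * N : ℝ) ≤ 2 ^ P := by exact_mod_cast hP
      have h4 : (1 / 2 : ℝ) ^ P * 2 ^ P = 1 := by rw [← mul_pow]; norm_num
      have h5 : (N : ℝ) * (1 - x) ≤ 2 ^ P / 3 * (1 / 2) ^ P := by
        gcongr
        linarith
      linarith
    calc _ ≤ (N : ℝ) ^ r * (1 - x) ^ r := by
          gcongr
      _ = ((N : ℝ) * (1 - x)) ^ r := by rw [mul_pow]
      _ ≤ _ := by
          gcongr
  · obtain ⟨p, hp, h1, h2⟩ := exists_dyadic_bracket (by linarith) P h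
    refine ⟨p, by omega, fun k _ r => ?_⟩
    have hc : dyadicCentre P p = 1 - 3 / 4 * (1 / 2) ^ p := by simp [dyadicCentre, hp]
    have hp0 : (0 : ℝ) < (1 / 2) ^ p := by positivity
    have hp1 : (1 / 2 : ℝ) ^ p ≤ 1 := pow_le_one₀ (by norm_num) (by norm_num)
    set τ := dyadicCentre P p
    have habs : |x - τ| ≤ (1 / 3) * (1 - τ) := by
      rw [hc, abs_le]
      rw [pow_succ] at h1
      constructor <;> linarith
    have hτ0 : 0 ≤ τ := by rw [hc]; linarith
    have hτ1 : τ ≤ 1 := by rw [hc]; linarith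
    calc _ ≤ (k.choose r : ℝ) * τ ^ (k - r) * ((1 / 3) * (1 - τ)) ^ r := by gcongr
      _ = (1 / 3) ^ r * ((k.choose r : ℝ) * τ ^ (k - r) * (1 - τ) ^ r) := by
          rw [mul_pow]; ring
      _ ≤ (1 / 3) ^ r * 1 := by
          gcongr
          exact choose_mul_pow_mul_pow_le_one hτ0 hτ1 k r
      _ = _ := mul_one _

/-- The tail of the binomial expansion is dominated by a geometric series of ratio 1/3, whose sum
gives the factor 3/2. -/
theorem abs_pow_sub_taylor_le {x τ : ℝ} {k : ℕ} (q : ℕ)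
    (h : ∀ r, (k.choose r : ℝ) * τ ^ (k - r) * |x - τ| ^ r ≤ (1 / 3) ^ r) (hτ : 0 ≤ τ) :
    |∑ r ∈ range q, (k.choose r : ℝ) * τ ^ (k - r) * (x - τ) ^ r - x ^ k| ≤
      3 / 2 * (1 / 3) ^ q := by
  -- Padding with vanishing binomial coefficients allows the split at q even when q > k.
  have h1 : x ^ k = ∑ r ∈ range (q + (k + 1)), (k.choose r : ℝ) * τ ^ (k - r) * (x - τ) ^ r := by
    conv_lhs => rw [← sub_add_cancel x τ, add_pow]
    rw [← sum_subset (range_subset_range.2 (by omega : k + 1 ≤ q + (k + 1)))]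
    · exact sum_congr rfl fun r _ => by ring
    · intro r _ hr
      rw [mem_range, not_lt] at hr
      rw [Nat.choose_eq_zero_of_lt (by omega)]
      simp
  rw [h1, sum_range_add, abs_sub_comm, add_sub_cancel_left]
  refine (abs_sum_le_sum_abs _ _).trans ?_
  calc _ ≤ ∑ s ∈ range (k + 1), (1 / 3 : ℝ) ^ q * (1 / 3) ^ s := by
        refine sum_le_sum fun s _ => ?_
        rw [← pow_add, abs_mul, abs_pow, abs_of_nonneg (by positivity)]
        exact h _
    _ = (1 / 3 : ℝ) ^ q * ∑ s ∈ range (k + 1), (1 / 3) ^ s := by rw [mul_sum]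
    _ ≤ (1 / 3 : ℝ) ^ q * (3 / 2) := by
        gcongr
        rw [geom_sum_eq (by norm_num)]
        have : (0 : ℝ) < (1 / 3) ^ (k + 1) := by positivity
        rw [div_le_iff_of_neg (by norm_num)]
        linarith
    _ = _ := by ring

theorem dyadicCentre_nonneg (P p : ℕ) : 0 ≤ dyadicCentre P p := by
  rw [dyadicCentre]
  split_ifs
  · have hp1 : (1 / 2 : ℝ) ^ p ≤ 1 := pow_le_one₀ (by norm_num) (by norm_num)
    linarith
  · norm_num

/-- The coefficients `sqrtCoeff` are approximated by few polynomial-exponential sequences. -/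
theorem exists_sqrtCoeff_approx {N P : ℕ} (hN : 0 < N) (hP : 3 * N ≤ 2 ^ P) (q : ℕ) :
    ∃ w : ℕ → ℕ → ℝ, ∀ k < N,
      |∑ p ∈ range (P + 1), ∑ r ∈ range q,
        w p r * ((k.choose r : ℝ) * dyadicCentre P p ^ (k - r)) - sqrtCoeff k| ≤
          3 / 2 * (1 / 3) ^ q := by
  set x : ℕ → ℝ := fun t => (1 + Real.cos (2 * Real.pi * (t + 0) / N)) / 2 with hx
  have hx0 : ∀ t, 0 ≤ x t := fun t => by
    have := Real.neg_one_le_cos (2 * Real.pi * (t + 0) / N)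
    rw [hx]; dsimp only; linarith
  have hx1 : ∀ t, x t ≤ 1 := fun t => by
    have := Real.cos_le_one (2 * Real.pi * (t + 0) / N)
    rw [hx]; dsimp only; linarith
  choose c hc hbound using fun t => exists_dyadicCentre hP (hx0 t) (hx1 t)
  -- The weights do not depend on k: they are the r-th moments, about the centre p, of the sample
  -- points assigned to it.
  refine ⟨fun p r => ∑ t ∈ range N, if c t = p then (1 / N : ℝ) * (x t - dyadicCentre P p) ^ r
    else 0, fun k hk => ?_⟩
  have h1 : ∑ p ∈ range (P + 1), ∑ r ∈ range q, (∑ t ∈ range N, if c t = p then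
      (1 / N : ℝ) * (x t - dyadicCentre P p) ^ r else 0) *
        ((k.choose r : ℝ) * dyadicCentre P p ^ (k - r)) =
      (1 / N : ℝ) * ∑ t ∈ range N, ∑ r ∈ range q, (k.choose r : ℝ) *
        dyadicCentre P (c t) ^ (k - r) * (x t - dyadicCentre P (c t)) ^ r := by
    have h2 : ∀ p, ∑ r ∈ range q, (∑ t ∈ range N, if c t = p then
      (1 / N : ℝ) * (x t - dyadicCentre P p) ^ r else 0) *
        ((k.choose r : ℝ) * dyadicCentre P p ^ (k - r)) =
        ∑ t ∈ range N, if c t = p then (1 / N : ℝ) * ∑ r ∈ range q, (k.choose r : ℝ) *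
        dyadicCentre P p ^ (k - r) * (x t - dyadicCentre P p) ^ r else 0 := by
      intro p
      simp_rw [sum_mul]
      rw [sum_comm]
      refine sum_congr rfl fun t _ => ?_
      split_ifs
      · rw [mul_sum]
        exact sum_congr rfl fun r _ => by ring
      · simp
    rw [sum_congr rfl fun p _ => h2 p, sum_comm, mul_sum]
    refine sum_congr rfl fun t _ => ?_
    rw [sum_ite_eq, if_pos (mem_range.2 (hc t))]
  have hN' : (N : ℝ) ≠ 0 := by exact_mod_cast hN.ne'
  rw [h1, sqrtCoeff_eq_average N k hk, ← mul_sub, ← sum_sub_distrib, abs_mul,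
    abs_of_nonneg (by positivity)]
  calc _ ≤ (1 / N : ℝ) * ∑ t ∈ range N, 3 / 2 * (1 / 3 : ℝ) ^ q := by
        gcongr
        refine (abs_sum_le_sum_abs _ _).trans (sum_le_sum fun t _ => ?_)
        exact abs_pow_sub_taylor_le q (fun r => hbound t k hk r) (dyadicCentre_nonneg _ _)
    _ = _ := by simp; field_simp

end Taylor

/-! ### Stability of the cofactor under perturbation -/

section Perturbation

open Finset PowerSeries

theorem abs_sum_antidiagonal_le {a b : ℕ → ℝ} {A B : ℝ} {k : ℕ} (ha : ∀ i ≤ k, |a i| ≤ A)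
    (hb : ∀ i ≤ k, |b i| ≤ B) :
    |∑ p ∈ antidiagonal k, a p.1 * b p.2| ≤ (k + 1) * (A * B) := by
  have hA : 0 ≤ A := (abs_nonneg _).trans (ha 0 (Nat.zero_le _))
  refine (abs_sum_le_sum_abs _ _).trans ?_
  calc _ ≤ ∑ p ∈ antidiagonal k, A * B := by
        refine sum_le_sum fun p hp => ?_
        have h := HasAntidiagonal.mem_antidiagonal.1 hp
        rw [abs_mul]
        exact mul_le_mul (ha _ (by omega)) (hb _ (by omega)) (abs_nonneg _) hA
    _ = _ := by simp

/-- A small perturbation `b` of `sqrtCoeff` has a cofactor that is close to `sqrtCoeff` as well. -/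
theorem exists_cofactor {N : ℕ} (hN : 0 < N) {b : ℕ → ℝ} {δ : ℝ} (hδ : 4 * (N : ℝ) ^ 3 * δ ≤ 1)
    (hb : ∀ k < N, |b k - sqrtCoeff k| ≤ δ) :
    ∃ c : ℕ → ℝ, (∀ k, ∑ p ∈ antidiagonal k, b p.1 * c p.2 = 1) ∧
      ∀ k < N, |c k - sqrtCoeff k| ≤ 1 / N := by
  have hN1 : (1 : ℝ) ≤ N := by exact_mod_cast hN
  have hδ0 : 0 ≤ δ := (abs_nonneg _).trans (hb 0 hN)
  have hb0 : b 0 ≠ 0 := by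
    intro h
    have h1 := hb 0 hN
    rw [h, sqrtCoeff_zero] at h1
    have h2 : (1 : ℝ) ≤ N ^ 3 := one_le_pow₀ hN1
    norm_num at h1
    nlinarith
  set F : ℝ⟦X⟧ := PowerSeries.mk sqrtCoeff with hF
  set Bs : ℝ⟦X⟧ := PowerSeries.mk b with hBs
  set U : ℝ⟦X⟧ := PowerSeries.mk fun _ => 1 with hU
  have hFF : F * F = U := by
    ext k
    rw [coeff_mul]
    simpa [hF, hU] using sum_antidiagonal_sqrtCoeff k
  have hUX : U * (1 - X) = 1 := PowerSeries.mk_one_mul_one_sub_eq_one ℝ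
  set Cs : ℝ⟦X⟧ := Bs⁻¹ * U with hCs
  have hBC : Bs * Cs = U := by
    rw [hCs, ← mul_assoc, PowerSeries.mul_inv_cancel, one_mul]
    simpa [hBs] using hb0
  set G : ℝ⟦X⟧ := F * (Bs - F) - X * (F * (Bs - F)) with hG
  have hid : Cs + G * Cs = F := by
    have : Cs + G * Cs = (1 - F * F * (1 - X)) * Cs + F * (1 - X) * (Bs * Cs) := by
      rw [hG]; ring
    rw [this, hFF, hUX, hBC, sub_self, zero_mul, zero_add, mul_assoc, mul_comm (1 - X), hUX,
      mul_one]
  have hH : ∀ k < N, |coeff k (F * (Bs - F))| ≤ N * δ := by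
    intro k hk
    rw [coeff_mul]
    have h1 := abs_sum_antidiagonal_le (a := sqrtCoeff) (b := fun k => b k - sqrtCoeff k)
      (A := 1) (B := δ) (k := k)
      (fun i _ => by rw [abs_of_pos (sqrtCoeff_pos i)]; exact sqrtCoeff_le_one i)
      (fun i hi => hb i (by omega))
    have h2 : ((k : ℝ) + 1) ≤ N := by exact_mod_cast hk
    simp only [hF, hBs, map_sub, coeff_mk]
    refine h1.trans ?_
    rw [one_mul]
    gcongr
  have hGk : ∀ k < N, |coeff k G| ≤ 2 * N * δ := by
    intro k hk
    rw [hG, map_sub]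
    refine (abs_sub _ _).trans ?_
    have h1 := hH k hk
    have h2 : |coeff k (X * (F * (Bs - F)))| ≤ N * δ := by
      rcases k with _ | k
      · simp; positivity
      · rw [coeff_succ_X_mul]; exact hH k (by omega)
    linarith
  have hη : N * (2 * N * δ) ≤ 1 / (2 * N) := by
    rw [le_div_iff₀ (by positivity)]
    nlinarith
  have hη' : 1 / (2 * N) ≤ (1 / 2 : ℝ) := by
    rw [div_le_div_iff₀ (by positivity) (by positivity)]
    linarith
  have hck : ∀ k, coeff k Cs = sqrtCoeff k -
      ∑ p ∈ antidiagonal k, coeff p.1 G * coeff p.2 Cs := by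
    intro k
    have h := congrArg (coeff k) hid
    rw [map_add, coeff_mul k G, hF, coeff_mk] at h
    linarith
  -- At the first index where the bound fails, the coefficient dominates all earlier ones, so the
  -- recursion gives |c| ≤ 1 + |c|/2, a contradiction.
  have hC2 : ∀ k < N, |coeff k Cs| ≤ 2 := by
    intro k
    induction k using Nat.strong_induction_on with
    | _ k ih =>
      intro hk
      by_contra! hlt
      have hA : ∀ i ≤ k, |coeff i Cs| ≤ |coeff k Cs| := by
        intro i hi
        rcases hi.lt_or_eq with h | h
        · exact (ih i h (by omega)).trans hlt.le
        · rw [h]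
      have h1 := abs_sum_antidiagonal_le (fun i hi => hGk i (by omega)) hA
      have h2 : |coeff k Cs| ≤ |sqrtCoeff k| +
          |∑ p ∈ antidiagonal k, coeff p.1 G * coeff p.2 Cs| := by
        conv_lhs => rw [hck k]
        exact abs_sub _ _
      rw [abs_of_pos (sqrtCoeff_pos k)] at h2
      have h3 := sqrtCoeff_le_one k
      have h4 : ((k : ℝ) + 1) ≤ N := by exact_mod_cast hk
      have h5 : ((k : ℝ) + 1) * (2 * N * δ * |coeff k Cs|) ≤ 1 / 2 * |coeff k Cs| := by
        calc _ ≤ N * (2 * N * δ * |coeff k Cs|) := by gcongr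
          _ = (N * (2 * N * δ)) * |coeff k Cs| := by ring
          _ ≤ _ := by
            gcongr
            exact hη.trans hη'
      linarith
  refine ⟨fun k => coeff k Cs, fun k => ?_, fun k hk => ?_⟩
  · have h := congrArg (coeff k) hBC
    rw [coeff_mul] at h
    simpa [hBs, hU] using h
  · have h1 := abs_sum_antidiagonal_le (k := k) (fun i hi => hGk i (by omega))
      (fun i hi => hC2 i (by omega))
    have h4 : ((k : ℝ) + 1) ≤ N := by exact_mod_cast hk
    dsimp only
    rw [hck k, sub_sub_cancel_left, abs_neg]
    calc _ ≤ _ := h1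
      _ ≤ N * (2 * N * δ * 2) := by gcongr
      _ = 2 * (N * (2 * N * δ)) := by ring
      _ ≤ 2 * (1 / (2 * N)) := by gcongr
      _ = _ := by field_simp

/-- Because the coefficients of (1-x)^(-1/2) are at most 1, an error of 1/N changes each square by
at most 3/N, hence the sum by at most 3. -/
theorem sum_sq_le_of_close {N : ℕ} (hN : 0 < N) {b : ℕ → ℝ}
    (hb : ∀ k < N, |b k - sqrtCoeff k| ≤ 1 / N) :
    ∑ k ∈ range N, b k ^ 2 ≤ Real.log N / Real.pi + 5 := by
  have hN1 : (1 : ℝ) ≤ N := by exact_mod_cast hN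
  have h1 : ∀ k ∈ range N, b k ^ 2 ≤ sqrtCoeff k ^ 2 + 3 * (1 / N) := by
    intro k hk
    have h2 := abs_le.1 (hb k (mem_range.1 hk))
    have h3 := sqrtCoeff_le_one k
    have h4 := sqrtCoeff_pos k
    have h5 : (1 / N : ℝ) ≤ 1 := by rw [div_le_one (by linarith)]; exact hN1
    nlinarith
  refine (sum_le_sum h1).trans ?_
  rw [sum_add_distrib, sum_const, card_range, nsmul_eq_mul]
  have h6 : (N : ℝ) * (3 * (1 / N)) = 3 := by field_simp
  linarith [sum_sqrtCoeff_sq_le N]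

end Perturbation

/-! ### Linear systems and the fast Toeplitz factorization -/

section Impulse

open Finset

/-- The impulse response of the linear system whose state `y` is updated on input `z` by
`y i ← τ i * y i + (z or y k)`. -/
noncomputable def impulse {ι : Type} (τ : ι → ℝ) (src : ι → Option ι) : ℕ → ι → ℝ
  | 0, i => (src i).elim 1 fun _ => 0
  | k + 1, i => τ i * impulse τ src k i + (src i).elim 0 fun j => impulse τ src k j

/-- The state of the linear system after the inputs `z 0, …, z (x - 1)`. -/
noncomputable def linState {ι : Type} (τ : ι → ℝ) (src : ι → Option ι) (z : ℕ → ℝ) : ℕ → ι → ℝ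
  | 0, _ => 0
  | x + 1, i => τ i * linState τ src z x i + (src i).elim (z x) fun j => linState τ src z x j

/-- By linearity and time invariance the state is a convolution. Input w first shows in the state at
time w + 1, hence the lag x - 1 - w. -/
theorem linState_eq_sum {ι : Type} (τ : ι → ℝ) (src : ι → Option ι) (z : ℕ → ℝ) (x : ℕ) (i : ι) :
    linState τ src z x i = ∑ w ∈ range x, impulse τ src (x - 1 - w) i * z w := by
  induction x generalizing i with
  | zero => simp [linState]
  | succ x ih =>
    rw [linState, sum_range_succ]
    have h1 : ∀ w ∈ range x, impulse τ src (x + 1 - 1 - w) i * z w =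
        τ i * (impulse τ src (x - 1 - w) i * z w) +
          ((src i).elim 0 fun j => impulse τ src (x - 1 - w) j) * z w := by
      intro w hw
      rw [mem_range] at hw
      have : x + 1 - 1 - w = (x - 1 - w) + 1 := by omega
      rw [this, impulse]; ring
    rw [sum_congr rfl h1, sum_add_distrib, ← mul_sum, ← ih]
    simp only [Nat.add_sub_cancel, Nat.sub_self]
    rcases h : src i with _ | j
    · simp [impulse, h]
    · simp [impulse, h, ih]

/-- A chain of `q` registers per centre yields the sequences `choose k r * τ ^ (k - r)`. -/
theorem impulse_chain {P q : ℕ} (τ : Fin P → ℝ) (k : ℕ) (i : Fin P × Fin q) :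
    impulse (fun i : Fin P × Fin q => τ i.1)
      (fun i => if (i.2 : ℕ) = 0 then none else some (i.1, ⟨i.2 - 1, by omega⟩)) k i =
      (k.choose i.2 : ℝ) * τ i.1 ^ (k - i.2) := by
  induction k generalizing i with
  | zero =>
    rw [impulse]
    split_ifs with h
    · simp [h]
    · simp [Nat.choose_eq_zero_of_lt (Nat.pos_of_ne_zero h)]
  | succ k ih =>
    rw [impulse, ih]
    split_ifs with h
    · simp [h]; ring
    · obtain ⟨p, r, hr⟩ := i
      obtain ⟨r, rfl⟩ := Nat.exists_eq_succ_of_ne_zero h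
      simp only [Option.elim, ih, Nat.succ_eq_add_one, Nat.add_sub_cancel, Nat.choose_succ_succ,
        Nat.add_sub_add_right]
      push_cast
      rcases le_or_gt (r + 1) k with hk | hk
      · have : k - r = k - (r + 1) + 1 := by omega
        rw [this, pow_succ]; ring
      · rw [Nat.choose_eq_zero_of_lt hk]; simp

/-- A factorization of the prefix sum matrix into lower triangular Toeplitz matrices of nearly
optimal error, whose left factor is the impulse response of a small linear system. -/
theorem exists_fast_toeplitz (N : ℕ) (hN : 2 ≤ N) :
    ∃ (ι : Type) (_ : Fintype ι) (τ : ι → ℝ) (src : ι → Option ι) (w : ι → ℝ) (c : ℕ → ℝ),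
      Fintype.card ι ≤ 10 * (Nat.log 2 N + 1) ^ 2 ∧
      (∀ k, ∑ p ∈ antidiagonal k, (∑ i, w i * impulse τ src p.1 i) * c p.2 = 1) ∧
      ∑ k ∈ range N, (∑ i, w i * impulse τ src k i) ^ 2 ≤ Real.log N / Real.pi + 5 ∧
      ∑ k ∈ range N, c k ^ 2 ≤ Real.log N / Real.pi + 5 := by
  set l := Nat.log 2 N + 1 with hl
  have hl2 : 2 ≤ l := by
    have : 0 < Nat.log 2 N := Nat.log_pos (by norm_num) hN
    omega
  have hNl : N ≤ 2 ^ l := (Nat.lt_pow_succ_log_self (by norm_num) N).le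
  have hN1 : (2 : ℝ) ≤ N := by exact_mod_cast hN
  -- The factor 2² = 4 covers the 3 in 3N ≤ 2^P; below, 3l terms of the Taylor order beat N³ and the
  -- extra 2 gives 3^(-2), which absorbs the constant 4 · 3/2.
  set P := l + 2
  set q := 3 * l + 2 with hq
  have hP : 3 * N ≤ 2 ^ P := by
    have : 2 ^ P = 2 ^ l * 4 := pow_add 2 l 2
    omega
  obtain ⟨w, hw⟩ := exists_sqrtCoeff_approx (by omega : 0 < N) hP q
  set δ : ℝ := 3 / 2 * (1 / 3) ^ q with hδ
  have hδN : 4 * (N : ℝ) ^ 3 * δ ≤ 1 := by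
    have h1 : (N : ℝ) ^ 3 ≤ 3 ^ (3 * l) := by
      have : (N : ℝ) ≤ 3 ^ l := by
        have h2 : (N : ℝ) ≤ 2 ^ l := by exact_mod_cast hNl
        exact h2.trans (by gcongr; norm_num)
      calc (N : ℝ) ^ 3 ≤ (3 ^ l) ^ 3 := by gcongr
        _ = _ := by rw [← pow_mul, mul_comm]
    have h3 : (1 / 3 : ℝ) ^ q * 3 ^ (3 * l) = 1 / 9 := by
      have : (1 / 3 : ℝ) ^ (3 * l) * 3 ^ (3 * l) = 1 := by rw [← mul_pow]; norm_num
      rw [hq, pow_add, mul_right_comm, this]; norm_num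
    have h4 : (1 / 3 : ℝ) ^ q * N ^ 3 ≤ 1 / 9 := by rw [← h3]; gcongr
    rw [hδ]; linarith
  have hδ0 : 0 ≤ δ := by positivity
  have hδ1 : δ ≤ 1 / N := by
    rw [le_div_iff₀ (by linarith)]
    nlinarith [mul_nonneg hδ0 (sq_nonneg (N : ℝ)), mul_nonneg hδ0 (by linarith : (0 : ℝ) ≤ N),
      mul_nonneg (mul_nonneg hδ0 (by linarith : (0 : ℝ) ≤ N))
        (by nlinarith : (0 : ℝ) ≤ (N : ℝ) ^ 2 - 1)]
  set τ : Fin (P + 1) × Fin q → ℝ := fun i => dyadicCentre P i.1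
  set src : Fin (P + 1) × Fin q → Option (Fin (P + 1) × Fin q) :=
    fun i => if (i.2 : ℕ) = 0 then none else some (i.1, ⟨i.2 - 1, by omega⟩)
  set b : ℕ → ℝ := fun k => ∑ i : Fin (P + 1) × Fin q, w i.1 i.2 * impulse τ src k i with hbdef
  have hb : ∀ k < N, |b k - sqrtCoeff k| ≤ δ := by
    intro k hk
    have : b k = ∑ p ∈ range (P + 1), ∑ r ∈ range q,
        w p r * ((k.choose r : ℝ) * dyadicCentre P p ^ (k - r)) := by
      rw [hbdef, Finset.sum_range]
      simp_rw [Finset.sum_range]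
      rw [Fintype.sum_prod_type]
      refine sum_congr rfl fun p _ => sum_congr rfl fun r _ => ?_
      rw [impulse_chain (fun p : Fin (P + 1) => dyadicCentre P p) k (p, r)]
    rw [this]
    exact hw k hk
  obtain ⟨c, hc, hcN⟩ := exists_cofactor (by omega : 0 < N) hδN hb
  refine ⟨Fin (P + 1) × Fin q, inferInstance, τ, src, fun i => w i.1 i.2, c, ?_, hc,
    sum_sq_le_of_close (by omega) fun k hk => (hb k hk).trans hδ1,
    sum_sq_le_of_close (by omega) hcN⟩
  rw [Fintype.card_prod, Fintype.card_fin, Fintype.card_fin]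
  -- Equality holds at l = 2, the smallest value that N ≥ 2 allows.
  change (l + 2 + 1) * (3 * l + 2) ≤ 10 * l ^ 2
  nlinarith

end Impulse

/-! ### The tree factorization -/

section Tree

open Finset

theorem sum_range_mul_block (a k : ℕ) (f : ℕ → ℝ) :
    ∑ c ∈ range (a * k), f c = ∑ w ∈ range a, ∑ t ∈ range k, f (w * k + t) := by
  induction a with
  | zero => simp
  | succ a ih => rw [Nat.succ_mul, sum_range_add, ih, sum_range_succ]

/-- The number of columns of the left factor for a complete `N`-ary tree of depth `l`. -/
def treeCols (N : ℕ) : ℕ → ℕ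
  | 0 => 1
  | l + 1 => N * (treeCols N l + 1)

/-- The left factor for an `N`-ary tree of depth `l`; the columns are in postorder. -/
noncomputable def treeB (N : ℕ) (b : ℕ → ℝ) : ℕ → ℕ → ℕ → ℝ
  | 0, _, _ => 1
  | l + 1, i, c =>
    if c % (treeCols N l + 1) < treeCols N l then
      if i / N ^ l = c / (treeCols N l + 1) then
        treeB N b l (i % N ^ l) (c % (treeCols N l + 1)) else 0
    else
      if c / (treeCols N l + 1) < i / N ^ l then
        b (i / N ^ l - 1 - c / (treeCols N l + 1)) else 0

/-- The right factor for an `N`-ary tree of depth `l`; the rows are in postorder. -/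
noncomputable def treeC (N : ℕ) (g : ℕ → ℝ) : ℕ → ℕ → ℕ → ℝ
  | 0, _, _ => 1
  | l + 1, c, j =>
    if c % (treeCols N l + 1) < treeCols N l then
      if j / N ^ l = c / (treeCols N l + 1) then
        treeC N g l (c % (treeCols N l + 1)) (j % N ^ l) else 0
    else
      if j / N ^ l ≤ c / (treeCols N l + 1) then
        g (c / (treeCols N l + 1) - j / N ^ l) else 0

theorem block_div_mod {I t : ℕ} (w : ℕ) (ht : t ≤ I) :
    (w * (I + 1) + t) / (I + 1) = w ∧ (w * (I + 1) + t) % (I + 1) = t := by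
  constructor
  · rw [mul_comm, Nat.mul_add_div (by omega), Nat.div_eq_of_lt (by omega), add_zero]
  · rw [mul_comm, Nat.mul_add_mod, Nat.mod_eq_of_lt (by omega)]

variable {N : ℕ} {b g : ℕ → ℝ}

theorem treeB_succ_inner (l i w t : ℕ) (ht : t < treeCols N l) :
    treeB N b (l + 1) i (w * (treeCols N l + 1) + t) =
      if i / N ^ l = w then treeB N b l (i % N ^ l) t else 0 := by
  obtain ⟨h1, h2⟩ := block_div_mod w ht.le
  rw [treeB, h1, h2, if_pos ht]

theorem treeB_succ_last (l i w : ℕ) :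
    treeB N b (l + 1) i (w * (treeCols N l + 1) + treeCols N l) =
      if w < i / N ^ l then b (i / N ^ l - 1 - w) else 0 := by
  obtain ⟨h1, h2⟩ := block_div_mod w (le_refl (treeCols N l))
  rw [treeB, h1, h2, if_neg (lt_irrefl _)]

theorem treeC_succ_inner (l j w t : ℕ) (ht : t < treeCols N l) :
    treeC N g (l + 1) (w * (treeCols N l + 1) + t) j =
      if j / N ^ l = w then treeC N g l t (j % N ^ l) else 0 := by
  obtain ⟨h1, h2⟩ := block_div_mod w ht.le
  rw [treeC, h1, h2, if_pos ht]

theorem treeC_succ_last (l j w : ℕ) :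
    treeC N g (l + 1) (w * (treeCols N l + 1) + treeCols N l) j =
      if j / N ^ l ≤ w then g (w - j / N ^ l) else 0 := by
  obtain ⟨h1, h2⟩ := block_div_mod w (le_refl (treeCols N l))
  rw [treeC, h1, h2, if_neg (lt_irrefl _)]

/-- The shift by one excludes the current child x itself: only complete earlier siblings are counted
here, the child's own part being left to the level below. -/
theorem sum_strict_toeplitz_mul {a x y : ℕ} (hx : x < a)
    (hbg : ∀ k, ∑ p ∈ antidiagonal k, b p.1 * g p.2 = 1) :
    ∑ w ∈ range a, (if w < x then b (x - 1 - w) else 0) * (if y ≤ w then g (w - y) else 0) =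
      if y < x then 1 else 0 := by
  rcases x with _ | x
  · simp
  · have := sum_toeplitz_mul (N := a) (j := y) (fun k _ => hbg k) (by omega : x < a)
    simpa only [Nat.lt_succ_iff, Nat.succ_eq_add_one, Nat.add_sub_cancel] using this

theorem sum_strict_toeplitz_row_sq_le {a x : ℕ} (hx : x < a) (haN : a ≤ N) :
    ∑ w ∈ range a, (if w < x then b (x - 1 - w) else 0) ^ 2 ≤ ∑ k ∈ range N, b k ^ 2 := by
  refine le_trans ?_ (sum_le_sum_of_subset_of_nonneg (range_subset_range.2 haN)
    fun _ _ _ => sq_nonneg _)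
  rcases x with _ | x
  · simpa using sum_nonneg fun _ _ => sq_nonneg _
  · have := sum_toeplitz_row_sq_le a b (by omega : x < a)
    simpa only [Nat.lt_succ_iff, Nat.succ_eq_add_one, Nat.add_sub_cancel] using this

/-- If j lies in an earlier child than i, the Toeplitz columns contribute 1; if both lie in the same
child, the diagonal block decides by induction; otherwise both parts vanish. The number a of
children is free because the root may have fewer than N. -/
theorem sum_treeB_mul_treeC_step {l : ℕ} (hN : 0 < N)
    (hbg : ∀ k, ∑ p ∈ antidiagonal k, b p.1 * g p.2 = 1)
    (ih : ∀ i < N ^ l, ∀ j < N ^ l,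
      ∑ c ∈ range (treeCols N l), treeB N b l i c * treeC N g l c j = if j ≤ i then 1 else 0)
    (a i j : ℕ) (hi : i < a * N ^ l) :
    ∑ c ∈ range (a * (treeCols N l + 1)), treeB N b (l + 1) i c * treeC N g (l + 1) c j =
      if j ≤ i then 1 else 0 := by
  have hR : 0 < N ^ l := by positivity
  have hx : i / N ^ l < a := Nat.div_lt_of_lt_mul (by rwa [mul_comm])
  rw [sum_range_mul_block]
  simp_rw [sum_range_succ, treeB_succ_last, treeC_succ_last]
  rw [sum_add_distrib, sum_strict_toeplitz_mul hx hbg]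
  have h1 : ∀ w ∈ range a, ∑ t ∈ range (treeCols N l),
      treeB N b (l + 1) i (w * (treeCols N l + 1) + t) *
        treeC N g (l + 1) (w * (treeCols N l + 1) + t) j =
      if i / N ^ l = w then (if j / N ^ l = i / N ^ l then
        (if j % N ^ l ≤ i % N ^ l then 1 else 0) else 0) else 0 := by
    intro w _
    by_cases h2 : i / N ^ l = w
    · subst h2
      by_cases h3 : j / N ^ l = i / N ^ l
      · rw [if_pos rfl, if_pos h3, ← ih _ (Nat.mod_lt _ hR) _ (Nat.mod_lt _ hR)]
        refine sum_congr rfl fun t ht => ?_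
        rw [treeB_succ_inner _ _ _ _ (mem_range.1 ht), treeC_succ_inner _ _ _ _ (mem_range.1 ht),
          if_pos rfl, if_pos h3]
      · rw [if_pos rfl, if_neg h3]
        refine sum_eq_zero fun t ht => ?_
        rw [treeC_succ_inner _ _ _ _ (mem_range.1 ht), if_neg h3, mul_zero]
    · rw [if_neg h2]
      refine sum_eq_zero fun t ht => ?_
      rw [treeB_succ_inner _ _ _ _ (mem_range.1 ht), if_neg h2, zero_mul]
  rw [sum_congr rfl h1, sum_ite_eq, if_pos (mem_range.2 hx)]
  have hi' := Nat.div_add_mod i (N ^ l)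
  have hj' := Nat.div_add_mod j (N ^ l)
  rcases lt_trichotomy (j / N ^ l) (i / N ^ l) with h | h | h
  · have : j < i := by
      by_contra! hc
      exact absurd (Nat.div_le_div_right (c := N ^ l) hc) (by omega)
    rw [if_neg h.ne, if_pos h, if_pos this.le, zero_add]
  · rw [if_pos h, if_neg h.not_lt, add_zero]
    rw [h] at hj'
    congr 1
    exact propext ⟨fun _ => by omega, fun _ => by omega⟩
  · have : i < j := by
      by_contra! hc
      exact absurd (Nat.div_le_div_right (c := N ^ l) hc) (by omega)
    rw [if_neg h.ne', if_neg (by omega), if_neg (by omega), zero_add]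

theorem sum_treeB_mul_treeC (hN : 0 < N) (hbg : ∀ k, ∑ p ∈ antidiagonal k, b p.1 * g p.2 = 1)
    (l : ℕ) : ∀ i < N ^ l, ∀ j < N ^ l,
      ∑ c ∈ range (treeCols N l), treeB N b l i c * treeC N g l c j =
        if j ≤ i then 1 else 0 := by
  induction l with
  | zero =>
    intro i hi j hj
    rw [pow_zero, Nat.lt_one_iff] at hi hj
    simp [treeCols, treeB, treeC, hi, hj]
  | succ l ih =>
    intro i hi j _
    exact sum_treeB_mul_treeC_step hN hbg ih N i j (by rwa [pow_succ, mul_comm] at hi)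

/-- A row meets the inner block of just one child, plus one Toeplitz row at this level, so each
level costs at most s. -/
theorem sum_treeB_sq_step {l : ℕ} (hN : 0 < N) {s β : ℝ} (hs : ∑ k ∈ range N, b k ^ 2 ≤ s)
    (ih : ∀ i < N ^ l, ∑ c ∈ range (treeCols N l), treeB N b l i c ^ 2 ≤ β)
    {a i : ℕ} (haN : a ≤ N) (hi : i < a * N ^ l) :
    ∑ c ∈ range (a * (treeCols N l + 1)), treeB N b (l + 1) i c ^ 2 ≤ β + s := by
  have hR : 0 < N ^ l := by positivity
  have hx : i / N ^ l < a := Nat.div_lt_of_lt_mul (by rwa [mul_comm])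
  rw [sum_range_mul_block]
  simp_rw [sum_range_succ, treeB_succ_last]
  rw [sum_add_distrib]
  refine add_le_add ?_ ((sum_strict_toeplitz_row_sq_le hx haN).trans hs)
  have h1 : ∀ w ∈ range a, ∑ t ∈ range (treeCols N l),
      treeB N b (l + 1) i (w * (treeCols N l + 1) + t) ^ 2 =
      if i / N ^ l = w then
        ∑ t ∈ range (treeCols N l), treeB N b l (i % N ^ l) t ^ 2 else 0 := by
    intro w _
    rw [sum_congr rfl fun t ht => by rw [treeB_succ_inner _ _ _ _ (mem_range.1 ht)]]
    split_ifs <;> simp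
  rw [sum_congr rfl h1, sum_ite_eq, if_pos (mem_range.2 hx)]
  exact ih _ (Nat.mod_lt _ hR)

theorem sum_treeC_sq_step {l : ℕ} (hN : 0 < N) {s β : ℝ} (hs : ∑ k ∈ range N, g k ^ 2 ≤ s)
    (ih : ∀ j < N ^ l, ∑ c ∈ range (treeCols N l), treeC N g l c j ^ 2 ≤ β)
    {a j : ℕ} (haN : a ≤ N) (hj : j < a * N ^ l) :
    ∑ c ∈ range (a * (treeCols N l + 1)), treeC N g (l + 1) c j ^ 2 ≤ β + s := by
  have hR : 0 < N ^ l := by positivity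
  have hx : j / N ^ l < a := Nat.div_lt_of_lt_mul (by rwa [mul_comm])
  rw [sum_range_mul_block]
  simp_rw [sum_range_succ, treeC_succ_last]
  rw [sum_add_distrib]
  refine add_le_add ?_ (((sum_toeplitz_col_sq_le a g _).trans (sum_le_sum_of_subset_of_nonneg
    (range_subset_range.2 haN) fun _ _ _ => sq_nonneg _)).trans hs)
  have h1 : ∀ w ∈ range a, ∑ t ∈ range (treeCols N l),
      treeC N g (l + 1) (w * (treeCols N l + 1) + t) j ^ 2 =
      if j / N ^ l = w then
        ∑ t ∈ range (treeCols N l), treeC N g l t (j % N ^ l) ^ 2 else 0 := by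
    intro w _
    rw [sum_congr rfl fun t ht => by rw [treeC_succ_inner _ _ _ _ (mem_range.1 ht)]]
    split_ifs <;> simp
  rw [sum_congr rfl h1, sum_ite_eq, if_pos (mem_range.2 hx)]
  exact ih _ (Nat.mod_lt _ hR)

theorem sum_treeB_sq_le (hN : 0 < N) {s : ℝ} (hs : ∑ k ∈ range N, b k ^ 2 ≤ s) (l : ℕ) :
    ∀ i < N ^ l, ∑ c ∈ range (treeCols N l), treeB N b l i c ^ 2 ≤ 1 + l * s := by
  induction l with
  | zero => simp [treeCols, treeB]
  | succ l ih =>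
    intro i hi
    refine (sum_treeB_sq_step hN hs ih le_rfl (by rwa [pow_succ, mul_comm] at hi)).trans
      (le_of_eq ?_)
    push_cast; ring

theorem sum_treeC_sq_le (hN : 0 < N) {s : ℝ} (hs : ∑ k ∈ range N, g k ^ 2 ≤ s) (l : ℕ) :
    ∀ j < N ^ l, ∑ c ∈ range (treeCols N l), treeC N g l c j ^ 2 ≤ 1 + l * s := by
  induction l with
  | zero => simp [treeCols, treeC]
  | succ l ih =>
    intro i hi
    refine (sum_treeC_sq_step hN hs ih le_rfl (by rwa [pow_succ, mul_comm] at hi)).trans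
      (le_of_eq ?_)
    push_cast; ring

/-- The summand 2 makes the induction close: the step leaves a surplus of N - 2. -/
theorem treeCols_add_two_le (hN : 2 ≤ N) (l : ℕ) : treeCols N l + 2 ≤ 3 * N ^ l := by
  induction l with
  | zero => simp [treeCols]
  | succ l ih =>
    rw [treeCols, pow_succ]
    nlinarith

/-- The tree factorization, cut to the first `n` rows and columns. -/
theorem tree_factorization (hN : 0 < N) (hbg : ∀ k, ∑ p ∈ antidiagonal k, b p.1 * g p.2 = 1)
    {s : ℝ} (hb : ∑ k ∈ range N, b k ^ 2 ≤ s) (hg : ∑ k ∈ range N, g k ^ 2 ≤ s)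
    {a l n : ℕ} (haN : a ≤ N) (hn0 : 0 < n) (hn : n ≤ a * N ^ l) :
    ∃ C : Matrix (Fin (a * (treeCols N l + 1))) (Fin n) ℝ,
      (Matrix.of fun (i : Fin n) (c : Fin (a * (treeCols N l + 1))) => treeB N b (l + 1) i c) * C =
        prefixSumMatrix n ∧
      MaxErr (Matrix.of fun (i : Fin n) (c : Fin (a * (treeCols N l + 1))) =>
        treeB N b (l + 1) i c) C ≤ 1 + l * s + s := by
  refine ⟨Matrix.of fun c j => treeC N g (l + 1) c j, ?_, maxErr_le hn0 _ _ (fun i => ?_)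
    fun j => ?_⟩
  · ext i j
    have h := sum_treeB_mul_treeC_step hN hbg (sum_treeB_mul_treeC hN hbg l) a i j
      (i.2.trans_le hn)
    rw [Finset.sum_range] at h
    simpa only [Matrix.mul_apply, Matrix.of_apply, prefixSumMatrix, Fin.le_def] using h
  · have h := sum_treeB_sq_step hN hb (sum_treeB_sq_le hN hb l) haN (i.2.trans_le hn)
    rw [Finset.sum_range] at h
    exact h
  · have h := sum_treeC_sq_step hN hg (sum_treeC_sq_le hN hg l) haN (j.2.trans_le hn)
    rw [Finset.sum_range] at h
    exact h

end Tree

/-! ### Named registers and a Hoare calculus with time bounds -/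

section Machine

/-- The registers: a counter, an accumulator, an input register, a buffer for state updates, and,
for every level of the tree, the partial outputs and the states of the linear systems. -/
inductive RegName (m L : ℕ) (ι : Type) : Type
  | cnt : RegName m L ι
  | acc : RegName m L ι
  | inp : RegName m L ι
  | buf (i : ι) : RegName m L ι
  | base (l : Fin (L + 2)) (j : Fin m) : RegName m L ι
  | st (l : Fin (L + 2)) (j : Fin m) (i : ι) : RegName m L ι

/-- The registers as a sum type. -/
def RegName.equivSum (m L : ℕ) (ι : Type) :
    RegName m L ι ≃ Fin 3 ⊕ ι ⊕ (Fin (L + 2) × Fin m) ⊕ (Fin (L + 2) × Fin m × ι) where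
  toFun
    | cnt => .inl 0
    | acc => .inl 1
    | inp => .inl 2
    | buf i => .inr (.inl i)
    | base l j => .inr (.inr (.inl (l, j)))
    | st l j i => .inr (.inr (.inr (l, j, i)))
  invFun
    | .inl 0 => cnt
    | .inl 1 => acc
    | .inl 2 => inp
    | .inr (.inl i) => buf i
    | .inr (.inr (.inl (l, j))) => base l j
    | .inr (.inr (.inr (l, j, i))) => st l j i
  left_inv r := by cases r <;> rfl
  right_inv r := by
    rcases r with r | r | r | r
    · fin_cases r <;> rfl
    all_goals rfl

theorem exists_regName_equiv (m L : ℕ) (ι : Type) [Fintype ι] :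
    Nonempty (RegName m L ι ≃
      Fin (3 + (Fintype.card ι + ((L + 2) * m + (L + 2) * (m * Fintype.card ι))))) := by
  refine ⟨(RegName.equivSum m L ι).trans (Fintype.equivFinOfCardEq ?_)⟩
  simp

variable {ρ : Type} {s : ℕ}

/-- A configuration with named registers. -/
def namedConfig (e : ρ ≃ Fin s) (σ : ρ → ℝ) (i o : List ℝ) (t : ℕ) : StreamConfig s :=
  ⟨fun r => σ (e.symm r), i, o, t⟩

/-- `σ'` arises from `σ` by storing `x` in register `r`. -/
def Assigns (σ σ' : ρ → ℝ) (r : ρ) (x : ℝ) : Prop := σ' r = x ∧ ∀ r', r' ≠ r → σ' r' = σ r'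

/-- From the given registers, input and output, the program terminates within `T` steps in a
configuration that satisfies `Q`. -/
def Ensures (e : ρ ≃ Fin s) (p : StreamProg s) (T : ℕ)
    (Q : (ρ → ℝ) → List ℝ → List ℝ → Prop) (σ : ρ → ℝ) (i o : List ℝ) : Prop :=
  ∀ t, ∃ σ' i' o' t', p.exec (namedConfig e σ i o t) = some (namedConfig e σ' i' o' t') ∧
    Q σ' i' o' ∧ t' ≤ t + T

variable {e : ρ ≃ Fin s} {p q : StreamProg s} {T T' : ℕ}
  {Q Q' : (ρ → ℝ) → List ℝ → List ℝ → Prop} {σ : ρ → ℝ} {i o : List ℝ}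

theorem Ensures.mono (h : Ensures e p T Q σ i o) (hT : T ≤ T')
    (hQ : ∀ σ i o, Q σ i o → Q' σ i o) : Ensures e p T' Q' σ i o := by
  intro t
  obtain ⟨σ', i', o', t', h1, h2, h3⟩ := h t
  exact ⟨σ', i', o', t', h1, hQ _ _ _ h2, by omega⟩

/-- In weakest-precondition style, the postcondition of the first program is the specification of
the second, so no intermediate assertion has to be named. -/
theorem Ensures.seq (h : Ensures e p T (Ensures e q T' Q) σ i o) :
    Ensures e (.seq p q) (T + T') Q σ i o := by
  intro t
  obtain ⟨σ', i', o', t', h1, h2, h3⟩ := h t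
  obtain ⟨σ'', i'', o'', t'', h4, h5, h6⟩ := h2 t'
  refine ⟨σ'', i'', o'', t'', ?_, h5, by omega⟩
  rw [StreamProg.exec, h1, Option.bind_some, h4]

theorem set_namedConfig (σ : ρ → ℝ) (i o : List ℝ) (t : ℕ) (r : ρ) (x : ℝ) :
    ∃ σ', Assigns σ σ' r x ∧
      (namedConfig e σ i o t).set (e r) x = namedConfig e σ' i o t := by
  classical
  refine ⟨Function.update σ r x, ⟨by simp, fun r' h => by simp [h]⟩, ?_⟩
  simp only [StreamConfig.set, namedConfig]
  congr 1
  funext k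
  by_cases h : k = e r
  · subst h; simp
  · have h' : e.symm k ≠ r := fun hk => h (by rw [← hk]; simp)
    simp [h, h']

theorem Ensures.of_set {x : ℝ} {r : ρ} {i' : List ℝ}
    (hp : ∀ t, p.exec (namedConfig e σ i o t) =
      some ((namedConfig e σ i' o (t + 1)).set (e r) x))
    (hQ : ∀ σ', Assigns σ σ' r x → Q σ' i' o) : Ensures e p 1 Q σ i o := by
  intro t
  obtain ⟨σ', h1, h2⟩ := set_namedConfig (e := e) σ i' o (t + 1) r x
  exact ⟨σ', i', o, t + 1, by rw [hp t, h2], hQ σ' h1, le_rfl⟩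

theorem Ensures.const {r : ρ} {x : ℝ} (hQ : ∀ σ', Assigns σ σ' r x → Q σ' i o) :
    Ensures e (.const (e r) x) 1 Q σ i o :=
  Ensures.of_set (fun _ => rfl) hQ

theorem Ensures.add {r a b : ρ} (hQ : ∀ σ', Assigns σ σ' r (σ a + σ b) → Q σ' i o) :
    Ensures e (.add (e r) (e a) (e b)) 1 Q σ i o :=
  Ensures.of_set (fun _ => by simp [StreamProg.exec, namedConfig, StreamConfig.tick]) hQ

theorem Ensures.sub {r a b : ρ} (hQ : ∀ σ', Assigns σ σ' r (σ a - σ b) → Q σ' i o) :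
    Ensures e (.sub (e r) (e a) (e b)) 1 Q σ i o :=
  Ensures.of_set (fun _ => by simp [StreamProg.exec, namedConfig, StreamConfig.tick]) hQ

theorem Ensures.mul {r a b : ρ} (hQ : ∀ σ', Assigns σ σ' r (σ a * σ b) → Q σ' i o) :
    Ensures e (.mul (e r) (e a) (e b)) 1 Q σ i o :=
  Ensures.of_set (fun _ => by simp [StreamProg.exec, namedConfig, StreamConfig.tick]) hQ

theorem Ensures.read {r : ρ} {x : ℝ} (hQ : ∀ σ', Assigns σ σ' r x → Q σ' i o) :
    Ensures e (.read (e r)) 1 Q σ (x :: i) o :=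
  Ensures.of_set (fun _ => rfl) hQ

theorem Ensures.write {r : ρ} (hQ : Q σ i (o ++ [σ r])) :
    Ensures e (.write (e r)) 1 Q σ i o := fun t =>
  ⟨σ, i, o ++ [σ r], t + 1, by
    simp [StreamProg.exec, namedConfig, StreamConfig.tick], hQ, le_rfl⟩

theorem Ensures.skip (hQ : Q σ i o) : Ensures e .skip 1 Q σ i o := fun t =>
  ⟨σ, i, o, t + 1, rfl, hQ, le_rfl⟩

theorem Ensures.ifPos {r : ρ} (hp : 0 < σ r → Ensures e p T Q σ i o)
    (hq : ¬ 0 < σ r → Ensures e q T Q σ i o) :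
    Ensures e (.ifPos (e r) p q) (T + 1) Q σ i o := by
  intro t
  by_cases h : 0 < σ r
  · obtain ⟨σ', i', o', t', h1, h2, h3⟩ := hp h (t + 1)
    refine ⟨σ', i', o', t', ?_, h2, by omega⟩
    rw [StreamProg.exec, if_pos (by simpa [namedConfig] using h)]
    exact h1
  · obtain ⟨σ', i', o', t', h1, h2, h3⟩ := hq h (t + 1)
    refine ⟨σ', i', o', t', ?_, h2, by omega⟩
    rw [StreamProg.exec, if_neg (by simpa [namedConfig] using h)]
    exact h1

theorem Ensures.loop {k : ℕ} (Inv : ℕ → (ρ → ℝ) → List ℝ → List ℝ → Prop) (h0 : Inv 0 σ i o)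
    (hstep : ∀ x < k, ∀ σ i o, Inv x σ i o → Ensures e p T (Inv (x + 1)) σ i o) :
    Ensures e (.loop k p) (1 + k * (1 + T)) (Inv k) σ i o := by
  intro t
  have key : ∀ x ≤ k, ∃ σ' i' o' t',
      (fun c : Option (StreamConfig s) => c.bind fun c' => p.exec c'.tick)^[x]
        (some (namedConfig e σ i o t).tick) = some (namedConfig e σ' i' o' t') ∧
      Inv x σ' i' o' ∧ t' ≤ t + (1 + x * (1 + T)) := by
    intro x
    induction x with
    | zero => exact fun _ => ⟨σ, i, o, t + 1, rfl, h0, by omega⟩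
    | succ x ih =>
      intro hx
      obtain ⟨σ', i', o', t', h1, h2, h3⟩ := ih (by omega)
      obtain ⟨σ'', i'', o'', t'', h4, h5, h6⟩ := hstep x (by omega) _ _ _ h2 (t' + 1)
      refine ⟨σ'', i'', o'', t'', ?_, h5, ?_⟩
      · rw [Function.iterate_succ_apply', h1]
        exact h4
      · rw [add_mul, one_mul]; omega
  exact key k le_rfl

/-- Run the programs `f 0, …, f (k - 1)` one after the other. -/
def forFin {s : ℕ} : (k : ℕ) → (Fin k → StreamProg s) → StreamProg s
  | 0, _ => .skip
  | k + 1, f => .seq (forFin k fun j => f j.castSucc) (f (Fin.last k))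

theorem size_forFin_le {k S : ℕ} (f : Fin k → StreamProg s) (hf : ∀ j, (f j).size ≤ S) :
    (forFin k f).size ≤ k * S + 1 := by
  induction k with
  | zero => simp [forFin, StreamProg.size]
  | succ k ih =>
    have h1 := ih (fun j => f j.castSucc) (fun j => hf _)
    have h2 := hf (Fin.last k)
    rw [forFin, StreamProg.size, add_mul, one_mul]
    omega

theorem Ensures.forFin {k : ℕ} {f : Fin k → StreamProg s}
    (Inv : ℕ → (ρ → ℝ) → List ℝ → List ℝ → Prop) (h0 : Inv 0 σ i o)
    (hstep : ∀ j : Fin k, ∀ σ i o, Inv j σ i o → Ensures e (f j) T (Inv (j + 1)) σ i o) :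
    Ensures e (forFin k f) (k * T + 1) (Inv k) σ i o := by
  induction k with
  | zero => exact (Ensures.skip h0).mono (by omega) fun _ _ _ h => h
  | succ k ih =>
    refine (Ensures.seq (T := k * T + 1) (T' := T) ?_).mono
      (by rw [add_mul, one_mul]; omega) fun _ _ _ h => h
    exact (ih (fun j σ i o h => hstep j.castSucc σ i o h)).mono le_rfl
      fun σ i o h => hstep (Fin.last k) σ i o h

/-- Run the programs `f i` for all `i` of a finite type. -/
noncomputable def forAll {ι : Type} [Fintype ι] (f : ι → StreamProg s) : StreamProg s :=
  forFin (Fintype.card ι) fun k => f ((Fintype.equivFin ι).symm k)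

theorem size_forAll_le {ι : Type} [Fintype ι] {S : ℕ} (f : ι → StreamProg s)
    (hf : ∀ j, (f j).size ≤ S) : (forAll f).size ≤ Fintype.card ι * S + 1 :=
  size_forFin_le _ fun _ => hf _

theorem Ensures.forAll {ι : Type} [Fintype ι] {f : ι → StreamProg s}
    (Inv : Finset ι → (ρ → ℝ) → List ℝ → List ℝ → Prop) (h0 : Inv ∅ σ i o)
    (hstep : ∀ S j (hj : j ∉ S) σ i o, Inv S σ i o →
      Ensures e (f j) T (Inv (Finset.cons j S hj)) σ i o) :
    Ensures e (forAll f) (Fintype.card ι * T + 1) (Inv Finset.univ) σ i o := by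
  have h := Ensures.forFin (e := e) (T := T) (σ := σ) (i := i) (o := o)
    (f := fun k => f ((Fintype.equivFin ι).symm k))
    (fun x => Inv (Finset.univ.filter fun j => (Fintype.equivFin ι j : ℕ) < x))
    (by simpa using h0) (by
      intro k σ i o h
      refine (hstep _ ((Fintype.equivFin ι).symm k) (by simp) σ i o h).mono le_rfl ?_
      intro σ i o h
      convert h using 1
      ext j
      simp only [Finset.mem_filter, Finset.mem_univ, true_and, Finset.mem_cons,
        Equiv.eq_symm_apply, Fin.ext_iff]
      omega)
  refine h.mono le_rfl fun σ i o h => ?_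
  convert h using 1
  ext j
  simp

end Machine

/-! ### The building blocks of the streaming program -/

section Blocks

open Finset

variable {m L s : ℕ} {ι : Type}

theorem drop_ofFn_eq_cons {k : ℕ} (z : Fin k → ℝ) (j : Fin k) :
    (List.ofFn z).drop j = z j :: (List.ofFn z).drop (j + 1) := by
  rw [List.drop_eq_getElem_cons (by simp)]
  simp

theorem take_ofFn_succ {k : ℕ} (z : Fin k → ℝ) (j : Fin k) :
    (List.ofFn z).take (j + 1) = (List.ofFn z).take j ++ [z j] := by
  rw [List.take_succ_eq_append_getElem (by simp)]
  simp

/-- Read a row of the input, add the outputs at level `0`, and write the sum while the counter is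
positive. -/
noncomputable def leafProg (e : RegName m L ι ≃ Fin s) : StreamProg s :=
  .seq (forFin m fun j => .seq (.read (e .inp)) (.seq (.add (e .inp) (e .inp) (e (.base 0 j)))
      (.ifPos (e .cnt) (.write (e .inp)) .skip)))
    (.ifPos (e .cnt) (.seq (.const (e .acc) 1) (.sub (e .cnt) (e .cnt) (e .acc))) .skip)

variable {e : RegName m L ι ≃ Fin s} {σ : RegName m L ι → ℝ} {i o : List ℝ}

theorem ensures_leafProg (z : Fin m → ℝ) (κ : ℕ) (hκ : σ .cnt = κ) :
    Ensures e (leafProg e) (m * 4 + 4)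
      (fun σ' i' o' => i' = i ∧
        o' = o ++ (if 0 < κ then List.ofFn fun j => σ (.base 0 j) + z j else []) ∧
        σ' .cnt = ((κ - 1 : ℕ) : ℝ) ∧
        ∀ r, r ≠ .acc → r ≠ .inp → r ≠ .cnt → σ' r = σ r) σ (List.ofFn z ++ i) o := by
  have hpos : ∀ σ' : RegName m L ι → ℝ, σ' .cnt = κ → (0 < σ' .cnt ↔ 0 < κ) := fun σ' h => by
    rw [h]; exact Nat.cast_pos
  refine (Ensures.seq (T := m * 4 + 1) (T' := 2 + 1) ?_).mono le_rfl fun _ _ _ h => h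
  refine (Ensures.forFin (T := 4) (fun x σ' i' o' => i' = (List.ofFn z).drop x ++ i ∧
    o' = o ++ (if 0 < κ then (List.ofFn fun j => σ (.base 0 j) + z j).take x else []) ∧
    ∀ r, r ≠ .inp → σ' r = σ r) ?_ ?_).mono le_rfl ?_
  · simp
  · rintro j σ₁ i₁ o₁ ⟨rfl, rfl, hframe⟩
    rw [drop_ofFn_eq_cons, List.cons_append]
    refine (Ensures.seq (T := 1) (T' := 1 + (1 + 1)) (Ensures.read fun σ₂ h₂ => Ensures.seq
      (Ensures.add fun σ₃ h₃ => ?_))).mono le_rfl fun _ _ _ h => h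
    have hframe' : ∀ r, r ≠ .inp → σ₃ r = σ r := fun r h => by
      rw [h₃.2 _ h, h₂.2 _ h, hframe _ h]
    have hc : σ₃ .cnt = κ := by rw [hframe' _ (by simp), hκ]
    refine Ensures.ifPos (fun h => Ensures.write ⟨rfl, ?_, hframe'⟩)
      (fun h => Ensures.skip ⟨rfl, ?_, hframe'⟩)
    · rw [hpos _ hc] at h
      rw [if_pos h, if_pos h, take_ofFn_succ, h₃.1, h₂.1, h₂.2 _ (by simp), hframe _ (by simp),
        List.append_assoc, add_comm (z j)]
    · rw [hpos _ hc] at h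
      rw [if_neg h, if_neg h]
  · rintro σ₁ i₁ o₁ ⟨rfl, rfl, hframe⟩
    have hc : σ₁ .cnt = κ := by rw [hframe _ (by simp), hκ]
    have hin : (List.ofFn z).drop m ++ i = i := by simp
    have hout : (List.ofFn fun j => σ (.base 0 j) + z j).take m =
        List.ofFn fun j => σ (.base 0 j) + z j := List.take_of_length_le (by simp)
    rw [hin, hout]
    -- Decrementing only a positive counter realises truncated subtraction.
    refine Ensures.ifPos (fun h => ?_) (fun h => ?_)
    · refine Ensures.seq (T := 1) (T' := 1) (Ensures.const fun σ₂ h₂ => Ensures.sub fun σ₃ h₃ =>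
        ⟨rfl, rfl, ?_, fun r h1 h2 h3 => ?_⟩)
      · rw [hpos _ hc] at h
        rw [h₃.1, h₂.1, h₂.2 _ (by simp), hc, Nat.cast_sub h, Nat.cast_one]
      · rw [h₃.2 _ h3, h₂.2 _ h1, hframe _ h2]
    · refine (Ensures.skip ⟨rfl, rfl, ?_, fun r _ h2 _ => hframe r h2⟩).mono (by omega)
        fun _ _ _ h => h
      rw [hpos _ hc] at h
      have : κ = 0 := by omega
      rw [hc, this]

variable [Fintype ι]

/-- Compute the outputs at level `a` from those at level `b` and the states at level `a`. -/
noncomputable def emitProg (e : RegName m L ι ≃ Fin s) (w : ι → ℝ) (a b : Fin (L + 2)) :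
    StreamProg s :=
  forFin m fun j =>
    .seq (.const (e .acc) 0) (.seq (.add (e (.base a j)) (e (.base b j)) (e .acc))
      (forAll fun i => .seq (.const (e .acc) (w i))
        (.seq (.mul (e .acc) (e .acc) (e (.st a j i)))
          (.add (e (.base a j)) (e (.base a j)) (e .acc)))))

/-- Read a row of the input and update the states at level `a` with it. -/
noncomputable def updateProg (e : RegName m L ι ≃ Fin s) (τ : ι → ℝ) (src : ι → Option ι)
    (a : Fin (L + 2)) : StreamProg s :=
  forFin m fun j =>
    .seq (.read (e .inp)) (.seq (forAll fun i => .seq (.const (e .acc) (τ i))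
        (.seq (.mul (e .acc) (e .acc) (e (.st a j i)))
          (.add (e (.buf i)) (e .acc) (e ((src i).elim .inp fun k => .st a j k)))))
      (.seq (.const (e .acc) 0) (forAll fun i => .add (e (.st a j i)) (e (.buf i)) (e .acc))))

/-- Clear the states at level `a`. -/
noncomputable def resetProg (e : RegName m L ι ≃ Fin s) (a : Fin (L + 2)) : StreamProg s :=
  forFin m fun j => forAll fun i => .const (e (.st a j i)) 0

theorem ensures_emitProg (w : ι → ℝ) {a b : Fin (L + 2)} (hab : a ≠ b) :
    Ensures e (emitProg e w a b) (m * (3 * Fintype.card ι + 3) + 1)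
      (fun σ' i' o' => i' = i ∧ o' = o ∧
        (∀ j, σ' (.base a j) = σ (.base b j) + ∑ k, w k * σ (.st a j k)) ∧
        ∀ r, r ≠ .acc → (∀ j, r ≠ .base a j) → σ' r = σ r) σ i o := by
  refine (Ensures.forFin (T := 3 * Fintype.card ι + 3) (fun x σ' i' o' => i' = i ∧ o' = o ∧
    (∀ j : Fin m, (j : ℕ) < x → σ' (.base a j) = σ (.base b j) + ∑ k, w k * σ (.st a j k)) ∧
    ∀ r, r ≠ .acc → (∀ j, r ≠ .base a j) → σ' r = σ r) ?_ ?_).mono le_rfl ?_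
  · simp
  · rintro j σ₁ i₁ o₁ ⟨rfl, rfl, hdone, hframe⟩
    refine (Ensures.seq (T := 1) (T' := 1 + (Fintype.card ι * 3 + 1))
      (Ensures.const fun σ₂ h₂ => Ensures.seq (Ensures.add fun σ₃ h₃ => ?_))).mono
      (by omega) fun _ _ _ h => h
    refine (Ensures.forAll (T := 3) (fun S σ' i' o' => i' = i₁ ∧ o' = o₁ ∧
      σ' (.base a j) = σ (.base b j) + ∑ k ∈ S, w k * σ (.st a j k) ∧
      ∀ r, r ≠ .acc → r ≠ .base a j → σ' r = σ₁ r) ?_ ?_).mono le_rfl ?_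
    · refine ⟨rfl, rfl, ?_, fun r h1 h2 => ?_⟩
      · rw [h₃.1, h₂.1, h₂.2 _ (by simp), hframe _ (by simp) (by simp [hab.symm])]
        simp
      · rw [h₃.2 _ h2, h₂.2 _ h1]
    · rintro S k hk σ₄ i₄ o₄ ⟨rfl, rfl, h4, h4f⟩
      refine (Ensures.seq (T := 1) (T' := 1 + 1) (Ensures.const fun σ₅ h₅ => Ensures.seq
        (Ensures.mul fun σ₆ h₆ => Ensures.add fun σ₇ h₇ => ?_))).mono le_rfl fun _ _ _ h => h
      refine ⟨rfl, rfl, ?_, fun r h1 h2 => ?_⟩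
      · rw [h₇.1, h₆.1, h₆.2 _ (by simp), h₅.1, h₅.2 _ (by simp), h₅.2 _ (by simp), h4,
          h4f _ (by simp) (by simp), hframe _ (by simp) (by simp), sum_cons]
        ring
      · rw [h₇.2 _ h2, h₆.2 _ h1, h₅.2 _ h1, h4f _ h1 h2]
    · rintro σ₄ i₄ o₄ ⟨rfl, rfl, h4, h4f⟩
      refine ⟨rfl, rfl, fun j' hj' => ?_, fun r h1 h2 => ?_⟩
      · rcases (Nat.lt_succ_iff.1 hj').lt_or_eq with h | h
        · rw [h4f _ (by simp) (by simp [Fin.ext_iff, h.ne]), hdone _ h]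
        · rw [Fin.ext h, h4]
      · rw [h4f _ h1 (h2 j), hframe _ h1 h2]
  · rintro σ₁ i₁ o₁ ⟨h1, h2, h3, h4⟩
    exact ⟨h1, h2, fun j => h3 j j.2, h4⟩

theorem ensures_updateProg (τ : ι → ℝ) (src : ι → Option ι) (a : Fin (L + 2)) (z : Fin m → ℝ) :
    Ensures e (updateProg e τ src a) (m * (4 * Fintype.card ι + 4) + 1)
      (fun σ' i' o' => i' = i ∧ o' = o ∧
        (∀ j k, σ' (.st a j k) =
          τ k * σ (.st a j k) + (src k).elim (z j) fun k' => σ (.st a j k')) ∧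
        ∀ r, r ≠ .acc → r ≠ .inp → (∀ k, r ≠ .buf k) → (∀ j k, r ≠ .st a j k) → σ' r = σ r)
      σ (List.ofFn z ++ i) o := by
  refine (Ensures.forFin (T := 4 * Fintype.card ι + 4) (fun x σ' i' o' =>
    i' = (List.ofFn z).drop x ++ i ∧ o' = o ∧
    (∀ j : Fin m, (j : ℕ) < x → ∀ k, σ' (.st a j k) =
      τ k * σ (.st a j k) + (src k).elim (z j) fun k' => σ (.st a j k')) ∧
    (∀ j : Fin m, x ≤ (j : ℕ) → ∀ k, σ' (.st a j k) = σ (.st a j k)) ∧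
    ∀ r, r ≠ .acc → r ≠ .inp → (∀ k, r ≠ .buf k) → (∀ j k, r ≠ .st a j k) → σ' r = σ r)
    ?_ ?_).mono le_rfl ?_
  · simp
  · rintro j σ₁ i₁ o₁ ⟨rfl, rfl, hdone, htodo, hframe⟩
    rw [drop_ofFn_eq_cons, List.cons_append]
    refine (Ensures.seq (T := 1)
      (T' := (Fintype.card ι * 3 + 1) + (1 + (Fintype.card ι * 1 + 1)))
      (Ensures.read fun σ₂ h₂ => Ensures.seq ?_)).mono (by omega) fun _ _ _ h => h
    -- The states must change simultaneously, since the new value of one uses the old value of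
    -- another; hence all new values go to the buffer first.
    refine (Ensures.forAll (T := 3) (fun S σ' i' o' =>
      i' = (List.ofFn z).drop (j + 1) ++ i ∧ o' = o₁ ∧
      (∀ k ∈ S, σ' (.buf k) = τ k * σ (.st a j k) +
        (src k).elim (z j) fun k' => σ (.st a j k')) ∧
      ∀ r, r ≠ .acc → (∀ k, r ≠ .buf k) → σ' r = σ₂ r) ?_ ?_).mono le_rfl ?_
    · simp
    · rintro S k hk σ₄ i₄ o₄ ⟨rfl, rfl, h4, h4f⟩
      refine (Ensures.seq (T := 1) (T' := 1 + 1) (Ensures.const fun σ₅ h₅ => Ensures.seq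
        (Ensures.mul fun σ₆ h₆ => Ensures.add fun σ₇ h₇ => ?_))).mono le_rfl fun _ _ _ h => h
      have hst : ∀ k', σ₄ (.st a j k') = σ (.st a j k') := fun k' => by
        rw [h4f _ (by simp) (by simp), h₂.2 _ (by simp), htodo _ le_rfl]
      refine ⟨rfl, rfl, fun k' hk' => ?_, fun r h1 h2 => ?_⟩
      · rcases mem_cons.1 hk' with rfl | hk'
        · rw [h₇.1, h₆.1, h₅.1, h₅.2 _ (by simp), hst]
          congr 1
          rcases src k' with _ | k''
          · simp only [Option.elim]
            rw [h₆.2 _ (by simp), h₅.2 _ (by simp), h4f _ (by simp) (by simp), h₂.1]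
          · simp only [Option.elim]
            rw [h₆.2 _ (by simp), h₅.2 _ (by simp), hst]
        · have hne : k' ≠ k := fun h => hk (h ▸ hk')
          rw [h₇.2 _ (by simp [hne]), h₆.2 _ (by simp), h₅.2 _ (by simp), h4 _ hk']
      · rw [h₇.2 _ (h2 k), h₆.2 _ h1, h₅.2 _ h1, h4f _ h1 h2]
    · rintro σ₃ i₃ o₃ ⟨rfl, rfl, h3, h3f⟩
      -- The machine has no move instruction; adding an accumulator that holds 0 copies the buffer.
      refine Ensures.seq (Ensures.const fun σ₄ h₄ => ?_)
      refine (Ensures.forAll (T := 1) (fun S σ' i' o' =>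
        i' = (List.ofFn z).drop (j + 1) ++ i ∧ o' = o₃ ∧
        (∀ k ∈ S, σ' (.st a j k) = τ k * σ (.st a j k) +
          (src k).elim (z j) fun k' => σ (.st a j k')) ∧
        ∀ r, (∀ k, r ≠ .st a j k) → σ' r = σ₄ r) ?_ ?_).mono le_rfl ?_
      · simp
      · rintro S k hk σ₅ i₅ o₅ ⟨rfl, rfl, h5, h5f⟩
        refine Ensures.add fun σ₆ h₆ => ⟨rfl, rfl, fun k' hk' => ?_, fun r h1 => ?_⟩
        · rcases mem_cons.1 hk' with rfl | hk'
          · rw [h₆.1, h5f _ (by simp), h5f _ (by simp), h₄.1, h₄.2 _ (by simp),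
              h3 _ (mem_univ _), add_zero]
          · have hne : k' ≠ k := fun h => hk (h ▸ hk')
            rw [h₆.2 _ (by simp [hne]), h5 _ hk']
        · rw [h₆.2 _ (h1 k), h5f _ h1]
      · rintro σ₅ i₅ o₅ ⟨rfl, rfl, h5, h5f⟩
        have hrest : ∀ r, r ≠ .acc → r ≠ .inp → (∀ k, r ≠ .buf k) → (∀ k, r ≠ .st a j k) →
            σ₅ r = σ₁ r := fun r h1 h2 h3 h4 => by
          rw [h5f _ h4, h₄.2 _ h1, h3f _ h1 h3, h₂.2 _ h2]
        refine ⟨rfl, rfl, fun j' hj' k => ?_, fun j' hj' k => ?_, fun r h1 h2 h3 h4 => ?_⟩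
        · rcases (Nat.lt_succ_iff.1 hj').lt_or_eq with h | h
          · rw [hrest _ (by simp) (by simp) (by simp) (by simp [Fin.ext_iff, h.ne]), hdone _ h]
          · rw [Fin.ext h, h5 _ (mem_univ _)]
        · have h : (j' : ℕ) ≠ j := by omega
          rw [hrest _ (by simp) (by simp) (by simp) (by simp [Fin.ext_iff, h]),
            htodo _ (by omega)]
        · rw [hrest _ h1 h2 h3 (h4 j), hframe _ h1 h2 h3 h4]
  · rintro σ₁ i₁ o₁ ⟨h1, h2, h3, -, h4⟩
    refine ⟨?_, h2, fun j k => h3 j j.2 k, h4⟩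
    rw [h1, List.drop_of_length_le (by simp), List.nil_append]

theorem ensures_resetProg (a : Fin (L + 2)) :
    Ensures e (resetProg e a) (m * (Fintype.card ι + 1) + 1)
      (fun σ' i' o' => i' = i ∧ o' = o ∧ (∀ j k, σ' (.st a j k) = 0) ∧
        ∀ r, (∀ j k, r ≠ .st a j k) → σ' r = σ r) σ i o := by
  refine (Ensures.forFin (T := Fintype.card ι + 1) (fun x σ' i' o' => i' = i ∧ o' = o ∧
    (∀ j : Fin m, (j : ℕ) < x → ∀ k, σ' (.st a j k) = 0) ∧
    ∀ r, (∀ j k, r ≠ .st a j k) → σ' r = σ r) ?_ ?_).mono le_rfl ?_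
  · simp
  · rintro j σ₁ i₁ o₁ ⟨rfl, rfl, hdone, hframe⟩
    refine (Ensures.forAll (T := 1) (fun S σ' i' o' => i' = i₁ ∧ o' = o₁ ∧
      (∀ k ∈ S, σ' (.st a j k) = 0) ∧ ∀ r, (∀ k, r ≠ .st a j k) → σ' r = σ₁ r)
      ?_ ?_).mono (by omega) ?_
    · simp
    · rintro S k hk σ₂ i₂ o₂ ⟨rfl, rfl, h2, h2f⟩
      refine Ensures.const fun σ₃ h₃ => ⟨rfl, rfl, fun k' hk' => ?_, fun r h1 => ?_⟩
      · rcases mem_cons.1 hk' with rfl | hk'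
        · rw [h₃.1]
        · have hne : k' ≠ k := fun h => hk (h ▸ hk')
          rw [h₃.2 _ (by simp [hne]), h2 _ hk']
      · rw [h₃.2 _ (h1 k), h2f _ h1]
    · rintro σ₂ i₂ o₂ ⟨rfl, rfl, h2, h2f⟩
      refine ⟨rfl, rfl, fun j' hj' k => ?_, fun r h1 => ?_⟩
      · rcases (Nat.lt_succ_iff.1 hj').lt_or_eq with h | h
        · rw [h2f _ (by simp [Fin.ext_iff, h.ne]), hdone _ h]
        · rw [Fin.ext h, h2 _ (mem_univ _)]
      · rw [h2f _ (h1 j), hframe _ h1]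
  · rintro σ₁ i₁ o₁ ⟨h1, h2, h3, h4⟩
    exact ⟨h1, h2, fun j k => h3 j j.2 k, h4⟩

end Blocks

/-! ### The streaming program for the tree: correctness, time and space -/

section TreeProgram

open Finset

/-- The concatenation of the first `k` rows. -/
def rows {m : ℕ} (Z : ℕ → Fin m → ℝ) (k : ℕ) : List ℝ :=
  (List.range k).flatMap fun t => List.ofFn (Z t)

theorem rows_zero {m : ℕ} (Z : ℕ → Fin m → ℝ) : rows Z 0 = [] := rfl

theorem rows_add {m : ℕ} (Z : ℕ → Fin m → ℝ) (p q : ℕ) :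
    rows Z (p + q) = rows Z p ++ rows (fun t => Z (p + t)) q := by
  simp [rows, List.range_add, List.flatMap_append, List.flatMap_map]

theorem rows_one {m : ℕ} (Z : ℕ → Fin m → ℝ) : rows Z 1 = List.ofFn (Z 0) := by
  simp [rows]

theorem rows_congr {m : ℕ} {Y Z : ℕ → Fin m → ℝ} {k : ℕ} (h : ∀ t < k, Y t = Z t) :
    rows Y k = rows Z k := by
  rw [rows, rows, List.flatMap_def, List.flatMap_def]
  congr 1
  exact List.map_congr_left fun t ht => by rw [h t (List.mem_range.1 ht)]

theorem rowStream_eq_rows {k m : ℕ} (Z : Matrix (Fin k) (Fin m) ℝ) (Y : ℕ → Fin m → ℝ)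
    (h : ∀ i : Fin k, Y i = Z i) : rowStream Z = rows Y k := by
  rw [rowStream, rows, List.flatMap_def]
  congr 1
  apply List.ext_getElem
  · simp
  · intro i h1 h2
    simp only [List.getElem_ofFn, List.getElem_map, List.getElem_range]
    rw [← h ⟨i, by simpa using h1⟩]

variable {m L s : ℕ} {ι : Type} [Fintype ι]

/-- The index of a level of the tree. -/
def level (L l : ℕ) : Fin (L + 2) := Fin.ofNat (L + 2) l

/-- Visit `a` children of a node at level `l + 1`, each processed by `body`. -/
noncomputable def nodeProg (e : RegName m L ι ≃ Fin s) (τ : ι → ℝ) (src : ι → Option ι)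
    (w : ι → ℝ) (l a : ℕ) (body : StreamProg s) : StreamProg s :=
  .seq (resetProg e (level L l)) (.loop a
    (.seq (emitProg e w (level L l) (level L (l + 1)))
      (.seq body (updateProg e τ src (level L l)))))

/-- The streaming multiplication by the left factor of the tree factorization. -/
noncomputable def treeProg (e : RegName m L ι ≃ Fin s) (τ : ι → ℝ) (src : ι → Option ι)
    (w : ι → ℝ) (N : ℕ) : ℕ → StreamProg s
  | 0 => leafProg e
  | l + 1 => nodeProg e τ src w l N (treeProg e τ src w N l)

theorem level_ne_level {l l' : ℕ} (h : l ≠ l') (hl : l ≤ L + 1) (hl' : l' ≤ L + 1) :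
    level L l ≠ level L l' := by
  intro hc
  have := congrArg Fin.val hc
  rw [level, level, Fin.val_ofNat, Fin.val_ofNat, Nat.mod_eq_of_lt (by omega),
    Nat.mod_eq_of_lt (by omega)] at this
  exact h this

/-- The program `p` multiplies the next `I` rows of the input by the `R × I` matrix `B`, adds the
outputs at level `l`, and writes the resulting rows while the counter is positive. -/
def BodySpec (e : RegName m L ι ≃ Fin s) (l R I : ℕ) (B : ℕ → ℕ → ℝ) (p : StreamProg s)
    (T : ℕ) : Prop :=
  ∀ (σ : RegName m L ι → ℝ) (Z : ℕ → Fin m → ℝ) (i o : List ℝ) (κ : ℕ), σ .cnt = κ →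
    Ensures e p T (fun σ' i' o' => i' = i ∧
      o' = o ++ rows (fun x j => σ (.base (level L l) j) +
        ∑ c ∈ range I, B x c * Z c j) (min κ R) ∧
      σ' .cnt = ((κ - R : ℕ) : ℝ) ∧
      ∀ l', l ≤ l' → l' ≤ L + 1 →
        (∀ j, σ' (.base (level L l') j) = σ (.base (level L l') j)) ∧
        ∀ j k, σ' (.st (level L l') j k) = σ (.st (level L l') j k))
      σ (rows Z I ++ i) o

variable {e : RegName m L ι ≃ Fin s} {τ : ι → ℝ} {src : ι → Option ι} {w : ι → ℝ} {N : ℕ}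

omit [Fintype ι] in
theorem bodySpec_leafProg (b : ℕ → ℝ) :
    BodySpec e 0 (N ^ 0) (treeCols N 0) (treeB N b 0) (leafProg e) (m * 4 + 4) := by
  intro σ Z i o κ hκ
  rw [treeCols, rows_one]
  refine (ensures_leafProg (Z 0) κ hκ).mono le_rfl ?_
  rintro σ' i' o' ⟨h1, h2, h3, h4⟩
  refine ⟨h1, ?_, by simpa using h3, fun l' _ _ => ⟨fun j => h4 _ (by simp) (by simp) (by simp),
    fun j k => h4 _ (by simp) (by simp) (by simp)⟩⟩
  rw [h2]
  congr 1
  split_ifs with h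
  · have : min κ (N ^ 0) = 1 := by rw [pow_zero]; omega
    rw [this, rows_one]
    simp [treeB, level]
  · have : min κ (N ^ 0) = 0 := by rw [pow_zero]; omega
    rw [this, rows_zero]

/-- Separates what is known before child x starts, a convolution of b with the closing rows of the
earlier children, from what is computed inside that child. -/
theorem sum_treeB_mul_stream {b : ℕ → ℝ} {l a x u : ℕ} (hx : x < a) (hu : u < N ^ l)
    (z : ℕ → ℝ) :
    ∑ c ∈ range (a * (treeCols N l + 1)), treeB N b (l + 1) (x * N ^ l + u) c * z c =
      ∑ v ∈ range x, b (x - 1 - v) * z (v * (treeCols N l + 1) + treeCols N l) +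
        ∑ c ∈ range (treeCols N l), treeB N b l u c * z (x * (treeCols N l + 1) + c) := by
  have hdiv : (x * N ^ l + u) / N ^ l = x := by
    rw [mul_comm, Nat.mul_add_div (by omega), Nat.div_eq_of_lt hu, add_zero]
  have hmod : (x * N ^ l + u) % N ^ l = u := by
    rw [mul_comm, Nat.mul_add_mod, Nat.mod_eq_of_lt hu]
  rw [sum_range_mul_block]
  simp_rw [sum_range_succ, treeB_succ_last, hdiv]
  rw [sum_add_distrib, add_comm]
  congr 1
  · rw [← sum_subset (range_subset_range.2 hx.le)]
    · refine sum_congr rfl fun v hv => ?_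
      rw [if_pos (mem_range.1 hv)]
    · intro v _ hv
      rw [if_neg (by rwa [mem_range] at hv), zero_mul]
  · rw [sum_eq_single_of_mem x (mem_range.2 hx)]
    · refine sum_congr rfl fun t ht => ?_
      rw [treeB_succ_inner _ _ _ _ (mem_range.1 ht), hdiv, hmod, if_pos rfl]
    · intro v _ hv
      refine sum_eq_zero fun t ht => ?_
      rw [treeB_succ_inner _ _ _ _ (mem_range.1 ht), hdiv, if_neg hv.symm, zero_mul]

/-- A bound for the time that a round of the loop of `nodeProg` takes in addition to its body. -/
def roundTime (m d : ℕ) : ℕ := m * (7 * d + 7) + 5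

/-- The loop invariant: after x children, the states at level l are those of the linear system fed
with the closing rows of these children. Their weighted sum is then the sibling part of the output,
which is handed to the body through the base registers at level l. Higher levels stay untouched, so
the enclosing loops keep their states. -/
theorem bodySpec_nodeProg {l a T : ℕ} {body : StreamProg s} (hl : l ≤ L)
    (h : BodySpec e l (N ^ l) (treeCols N l)
      (treeB N (fun k => ∑ i, w i * impulse τ src k i) l) body T) :
    BodySpec e (l + 1) (a * N ^ l) (a * (treeCols N l + 1))
      (treeB N (fun k => ∑ i, w i * impulse τ src k i) (l + 1)) (nodeProg e τ src w l a body)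
      (roundTime m (Fintype.card ι) + a * (roundTime m (Fintype.card ι) + T)) := by
  set d := Fintype.card ι
  set b : ℕ → ℝ := fun k => ∑ i, w i * impulse τ src k i
  set I := treeCols N l with hI
  set R := N ^ l with hR
  intro σ Z i o κ hκ
  set Y : ℕ → Fin m → ℝ := fun x j => σ (.base (level L (l + 1)) j) +
    ∑ c ∈ range (a * (I + 1)), treeB N b (l + 1) x c * Z c j with hY
  have hne : ∀ l', l + 1 ≤ l' → l' ≤ L + 1 → level L l' ≠ level L l :=
    fun l' h1 h2 => level_ne_level (by omega) h2 (by omega)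
  refine (Ensures.seq (T := m * (d + 1) + 1)
    (T' := 1 + a * (1 + ((m * (3 * d + 3) + 1) + (T + (m * (4 * d + 4) + 1)))))
    ((ensures_resetProg _).mono le_rfl ?_)).mono ?_ fun _ _ _ h => h
  swap
  · have h1 : 1 + ((m * (3 * d + 3) + 1) + (T + (m * (4 * d + 4) + 1))) ≤
        roundTime m d + T := by rw [roundTime]; nlinarith
    have h2 : m * (d + 1) + 1 + 1 ≤ roundTime m d := by rw [roundTime]; nlinarith
    have h3 := Nat.mul_le_mul_left a h1
    omega
  rintro σ₁ i₁ o₁ ⟨rfl, rfl, h1s, h1f⟩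
  refine (Ensures.loop (fun x σ' i' o' =>
    i' = rows (fun t => Z (x * (I + 1) + t)) ((a - x) * (I + 1)) ++ i ∧
    o' = o₁ ++ rows Y (min κ (x * R)) ∧ σ' .cnt = ((κ - x * R : ℕ) : ℝ) ∧
    (∀ j k, σ' (.st (level L l) j k) =
      linState τ src (fun v => Z (v * (I + 1) + I) j) x k) ∧
    ∀ l', l + 1 ≤ l' → l' ≤ L + 1 →
      (∀ j, σ' (.base (level L l') j) = σ (.base (level L l') j)) ∧
      ∀ j k, σ' (.st (level L l') j k) = σ (.st (level L l') j k))
    ?_ ?_).mono le_rfl ?_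
  · refine ⟨by simp, by simp [rows_zero], ?_, ?_, ?_⟩
    · rw [h1f _ (by simp), hκ]; simp
    · intro j k; rw [h1s]; rfl
    · intro l' h2 h3
      exact ⟨fun j => h1f _ (by simp), fun j k => h1f _ (by simp [hne l' h2 h3])⟩
  · rintro x hx σ₂ i₂ o₂ ⟨rfl, rfl, h2c, h2s, h2f⟩
    -- Postorder: the rows of the child's subtree, then its closing row, then the remaining
    -- children.
    have hin : rows (fun t => Z (x * (I + 1) + t)) ((a - x) * (I + 1)) =
        rows (fun t => Z (x * (I + 1) + t)) I ++ (List.ofFn (Z (x * (I + 1) + I)) ++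
          rows (fun t => Z ((x + 1) * (I + 1) + t)) ((a - (x + 1)) * (I + 1))) := by
      have h1 : (a - x) * (I + 1) = I + (1 + (a - (x + 1)) * (I + 1)) := by
        have : a - x = (a - (x + 1)) + 1 := by omega
        rw [this, add_mul, one_mul]; ring
      rw [h1, rows_add, rows_add, rows_one]
      congr 3
      funext t
      congr 1
      ring
    rw [hin, List.append_assoc, List.append_assoc]
    refine Ensures.seq ((ensures_emitProg w (hne (l + 1) le_rfl (by omega)).symm).mono le_rfl ?_)
    rintro σ₃ i₃ o₃ ⟨rfl, rfl, h3b, h3f⟩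
    refine Ensures.seq ((h σ₃ _ _ _ (κ - x * R)
      (by rw [h3f _ (by simp) (by simp), h2c])).mono le_rfl ?_)
    rintro σ₄ i₄ o₄ ⟨rfl, rfl, h4c, h4f⟩
    refine (ensures_updateProg τ src _ _).mono le_rfl ?_
    rintro σ₅ i₅ o₅ ⟨rfl, rfl, h5s, h5f⟩
    have hst : ∀ j k, σ₄ (.st (level L l) j k) =
        linState τ src (fun v => Z (v * (I + 1) + I) j) x k := fun j k => by
      rw [(h4f l le_rfl (by omega)).2, h3f _ (by simp) (by simp), h2s]
    refine ⟨rfl, ?_, ?_, fun j k => ?_, fun l' hl1 hl2 => ⟨fun j => ?_, fun j k => ?_⟩⟩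
    · have hbase : ∀ u < R, (fun j => σ₃ (.base (level L l) j) +
          ∑ c ∈ range I, treeB N b l u c * Z (x * (I + 1) + c) j) = Y (x * R + u) := by
        intro u hu
        funext j
        rw [hY]
        dsimp only
        rw [sum_treeB_mul_stream hx hu fun c => Z c j, h3b,
          (h2f (l + 1) le_rfl (by omega)).1]
        simp_rw [h2s, linState_eq_sum, mul_sum]
        rw [sum_comm, add_assoc]
        congr 2
        refine sum_congr rfl fun v _ => ?_
        rw [sum_mul]
        exact sum_congr rfl fun k _ => by ring
      rw [List.append_assoc]
      congr 1
      rw [rows_congr (Z := fun u => Y (x * R + u)) fun u hu => hbase u (by omega)]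
      have hmul : (x + 1) * R = x * R + R := by rw [add_mul, one_mul]
      -- Either the counter has already run out and nothing more is written, or all earlier children
      -- have written all their rows.
      rcases le_or_gt κ (x * R) with hk | hk
      · have h1 : κ - x * R = 0 := by omega
        have h2 : min κ ((x + 1) * R) = min κ (x * R) := by omega
        rw [h1, h2, Nat.zero_min, rows_zero, List.append_nil]
      · have h1 : min κ (x * R) = x * R := by omega
        have h2 : min κ ((x + 1) * R) = x * R + min (κ - x * R) R := by omega
        rw [h1, h2, rows_add]
    · rw [h5f _ (by simp) (by simp) (by simp) (by simp), h4c]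
      congr 1
      rw [add_mul, one_mul]
      omega
    · rw [h5s, linState]
      simp_rw [hst]
    · rw [h5f _ (by simp) (by simp) (by simp) (by simp), (h4f l' (by omega) hl2).1,
        h3f _ (by simp) (by simp [hne l' hl1 hl2]), (h2f l' hl1 hl2).1]
    · rw [h5f _ (by simp) (by simp) (by simp) (by simp [hne l' hl1 hl2]),
        (h4f l' (by omega) hl2).2, h3f _ (by simp) (by simp), (h2f l' hl1 hl2).2]
  · rintro σ₂ i₂ o₂ ⟨h2i, h2o, h2c, -, h2f⟩
    exact ⟨by simpa [rows_zero] using h2i, h2o, h2c, h2f⟩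

/-- The time satisfies T' = D + N(D + T), with D the overhead of a round; the offset 3D makes a
bound linear in N^l inductive as soon as N ≥ 2. -/
theorem bodySpec_treeProg (hN : 2 ≤ N) (l : ℕ) (hl : l ≤ L + 1) :
    ∃ T, T + 3 * roundTime m (Fintype.card ι) ≤ 4 * roundTime m (Fintype.card ι) * N ^ l ∧
      BodySpec e l (N ^ l) (treeCols N l)
        (treeB N (fun k => ∑ i, w i * impulse τ src k i) l) (treeProg e τ src w N l) T := by
  induction l with
  | zero =>
    refine ⟨m * 4 + 4, ?_, bodySpec_leafProg _⟩
    rw [pow_zero, roundTime]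
    nlinarith [Nat.zero_le (m * Fintype.card ι)]
  | succ l ih =>
    obtain ⟨T, hT, hspec⟩ := ih (by omega)
    refine ⟨roundTime m (Fintype.card ι) + N * (roundTime m (Fintype.card ι) + T), ?_, ?_⟩
    swap
    · have h := bodySpec_nodeProg (a := N) (by omega : l ≤ L) hspec
      rw [mul_comm N (N ^ l), ← pow_succ] at h
      exact h
    · set D := roundTime m (Fintype.card ι)
      have h1 : N * (T + 3 * D) ≤ N * (4 * D * N ^ l) := Nat.mul_le_mul_left N hT
      have h2 : 2 * D ≤ N * D := Nat.mul_le_mul_right D hN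
      rw [pow_succ]
      nlinarith

theorem size_nodeProg_le (l a : ℕ) (body : StreamProg s) :
    (nodeProg e τ src w l a body).size ≤ 8 * (m * (Fintype.card ι + 1) + 1) + body.size := by
  have h1 : (resetProg e (level L l)).size ≤ m * (Fintype.card ι * 1 + 1) + 1 :=
    size_forFin_le _ fun j => size_forAll_le _ fun k => le_rfl
  have h2 : (emitProg e w (level L l) (level L (l + 1))).size ≤
      m * (Fintype.card ι * 3 + 1 + 2) + 1 := by
    refine size_forFin_le _ fun j => ?_
    have := size_forAll_le (S := 3) (fun i => .seq (.const (e .acc) (w i))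
        (.seq (.mul (e .acc) (e .acc) (e (.st (level L l) j i)))
          (.add (e (.base (level L l) j)) (e (.base (level L l) j))
            (e .acc)))) fun _ => le_rfl
    simp only [StreamProg.size] at this ⊢
    omega
  have h3 : (updateProg e τ src (level L l)).size ≤
      m * (Fintype.card ι * 4 + 4) + 1 := by
    refine size_forFin_le _ fun j => ?_
    have h4 := size_forAll_le (S := 3) (fun i => .seq (.const (e .acc) (τ i))
        (.seq (.mul (e .acc) (e .acc) (e (.st (level L l) j i)))
          (.add (e (.buf i)) (e .acc)
            (e ((src i).elim .inp fun k => .st (level L l) j k))))) fun _ => le_rfl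
    have h5 := size_forAll_le (S := 1) (fun i => .add (e (.st (level L l) j i))
      (e (.buf i)) (e .acc)) fun _ => le_rfl
    simp only [StreamProg.size] at h4 h5 ⊢
    omega
  simp only [nodeProg, StreamProg.size]
  nlinarith

omit [Fintype ι] in
theorem size_leafProg_le : (leafProg e).size ≤ 5 * m + 5 := by
  have h : (forFin m fun j => .seq (.read (e .inp)) (.seq (.add (e .inp) (e .inp) (e (.base 0 j)))
      (.ifPos (e .cnt) (.write (e .inp)) .skip))).size ≤ m * 5 + 1 :=
    size_forFin_le _ fun _ => le_rfl
  simp only [leafProg, StreamProg.size] at h ⊢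
  omega

/-- A loop body is stored once however often it runs, so each level adds a fixed amount of text
instead of multiplying it by N. -/
theorem size_treeProg_le (l : ℕ) :
    (treeProg e τ src w N l).size ≤ (l + 1) * (8 * (m * (Fintype.card ι + 1) + 1)) := by
  induction l with
  | zero =>
    refine size_leafProg_le.trans ?_
    nlinarith [Nat.zero_le (m * Fintype.card ι)]
  | succ l ih =>
    refine (size_nodeProg_le l N _).trans ?_
    rw [add_mul (l + 1), one_mul]
    omega

/-- The left factor of the tree factorization can be multiplied in a streaming fashion. -/
theorem exists_streamProg {m : ℕ} (hm : 1 ≤ m) (τ : ι → ℝ) (src : ι → Option ι) (w : ι → ℝ)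
    {N : ℕ} (hN : 2 ≤ N) (l a n : ℕ) (hn : n ≤ a * N ^ l) :
    ∃ (s : ℕ) (p : StreamProg s) (T : ℕ),
      T ≤ roundTime m (Fintype.card ι) * (5 * (a * N ^ l) + 2) ∧
      p.space ≤ 14 * ((l + 2) * (m * (Fintype.card ι + 1) + 1)) ∧
      p.Multiplies (Matrix.of fun (i : Fin n) (c : Fin (a * (treeCols N l + 1))) =>
        treeB N (fun k => ∑ i, w i * impulse τ src k i) (l + 1) i c) m T := by
  -- Levels 0 to l + 1 are available. The base registers at level l + 1 are never written and keep
  -- their initial value 0.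
  obtain ⟨e⟩ := exists_regName_equiv m l ι
  obtain ⟨T, hT, hspec⟩ :=
    bodySpec_treeProg (e := e) (τ := τ) (src := src) (w := w) hN l (by omega)
  set D := roundTime m (Fintype.card ι) with hD
  have hnode := bodySpec_nodeProg (a := a) le_rfl hspec
  -- The counter starts at n, so that of the a * N ^ l leaves only the first n produce output,
  -- although all input rows are read.
  refine ⟨_, .seq (.const (e .cnt) n) (nodeProg e τ src w l a (treeProg e τ src w N l)),
    1 + (D + a * (D + T)), ?_, ?_, ?_⟩
  · have h1 : a * (T + 3 * D) ≤ a * (4 * D * N ^ l) := Nat.mul_le_mul_left a hT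
    have h2 : 1 ≤ D := by rw [hD, roundTime]; omega
    have h3 : D * (a * 1) ≤ D * (a * N ^ l) :=
      Nat.mul_le_mul_left D (Nat.mul_le_mul_left a (Nat.one_le_pow _ _ (by omega)))
    nlinarith
  · have h1 := size_nodeProg_le (e := e) (τ := τ) (src := src) (w := w) l a
      (treeProg e τ src w N l)
    have h2 := size_treeProg_le (e := e) (τ := τ) (src := src) (w := w) (N := N) l
    simp only [StreamProg.space, StreamProg.size]
    nlinarith [Nat.zero_le (l * m * Fintype.card ι), Nat.zero_le (l * m),
      Nat.mul_le_mul_right (Fintype.card ι) hm]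
  · intro Z
    set Zx : ℕ → Fin m → ℝ :=
      fun t j => if h : t < a * (treeCols N l + 1) then Z ⟨t, h⟩ j else 0 with hZx
    have hZ : rowStream Z = rows Zx (a * (treeCols N l + 1)) :=
      rowStream_eq_rows Z Zx fun i => by funext j; simp [hZx]
    have hrun : Ensures e (.seq (.const (e .cnt) n)
        (nodeProg e τ src w l a (treeProg e τ src w N l))) (1 + (D + a * (D + T)))
        (fun _ i' o' => i' = [] ∧ o' = [] ++ rows (fun x j => 0 +
          ∑ c ∈ range (a * (treeCols N l + 1)),
            treeB N (fun k => ∑ i, w i * impulse τ src k i) (l + 1) x c * Zx c j)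
          (min n (a * N ^ l))) (fun _ => 0) (rows Zx (a * (treeCols N l + 1)) ++ []) [] := by
      refine Ensures.seq (Ensures.const fun σ hσ => ?_)
      refine (hnode σ Zx [] [] n hσ.1).mono le_rfl ?_
      rintro σ' i' o' ⟨h1, h2, -, -⟩
      refine ⟨h1, ?_⟩
      rw [h2]
      congr 2
      funext x j
      rw [hσ.2 _ (by simp)]
    obtain ⟨σ', i', o', t', h1, ⟨h2, h3⟩, h4⟩ := hrun 0
    refine ⟨namedConfig e σ' i' o' t', ?_, h2, ?_, ?_⟩
    · rw [hZ, ← h1, List.append_nil]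
      rfl
    · change o' = _
      rw [h3, List.nil_append, min_eq_left hn]
      symm
      apply rowStream_eq_rows
      intro i
      funext j
      rw [Matrix.mul_apply, Finset.sum_range]
      simp [hZx]
    · change (t' : ℝ) ≤ _
      exact_mod_cast (by omega : t' ≤ 1 + (D + a * (D + T)))

end TreeProgram

/-! ### Choice of parameters and the final bounds -/

section Main

theorem lt_log_two : (0.69 : ℝ) < Real.log 2 := by
  linarith [Real.log_two_gt_d9]

theorem lt_log_natCast {N : ℕ} (hN : 2 ≤ N) : (0.69 : ℝ) < Real.log N :=
  lt_log_two.trans_le (Real.log_le_log (by norm_num) (by exact_mod_cast hN))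

theorem natLog_mul_log_le {b n : ℕ} (hb : 0 < b) (hn : n ≠ 0) :
    (Nat.log b n : ℝ) * Real.log b ≤ Real.log n := by
  have h : ((b ^ Nat.log b n : ℕ) : ℝ) ≤ n := by exact_mod_cast Nat.pow_log_le_self b hn
  rw [← Real.log_pow]
  push_cast at h
  exact Real.log_le_log (by positivity) h

theorem natLog_two_succ_le {N : ℕ} (hN : 2 ≤ N) : (Nat.log 2 N + 1 : ℝ) ≤ 3 * Real.log N := by
  have h1 := natLog_mul_log_le (b := 2) (n := N) (by norm_num) (by omega)
  have h2 := lt_log_natCast hN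
  have h3 := lt_log_two
  have h4 : (0 : ℝ) ≤ Nat.log 2 N := Nat.cast_nonneg _
  push_cast at h1
  nlinarith

/-- Here x, y, z stand for log N, log n, log n₁ and v for the optimum. The loss 5y/x is of order v/z
+ 1/z if N = n₁, and equals 5 if N = n; the bound 0.69 < z lets a multiple of z absorb the
constants. -/
theorem error_bound {x y z v : ℝ} (hx : 0.69 < x) (hxz : x ≤ z) (hv : 0 ≤ v)
    (hz : z = x ∨ y = x) (hopt : |v - y / Real.pi| ≤ 2) :
    6 + y / Real.pi + 5 * (y / x) + x ≤ v * (1 + 8000 / z) + 8000 * z := by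
  have hz0 : 0 < z := by linarith
  obtain ⟨h1, -⟩ := abs_le.1 hopt
  have hy : y ≤ 4 * (v + 2) := by
    have h2 : y / Real.pi ≤ v + 2 := by linarith
    rw [div_le_iff₀ Real.pi_pos] at h2
    nlinarith [Real.pi_le_four]
  have hvz : 0 ≤ v / z := by positivity
  have h2 : v * (1 + 8000 / z) = v + 8000 * (v / z) := by ring
  rw [h2]
  rcases hz with hz | hz
  · have h3 : y / x ≤ 4 * (v / z) + 8 / z := by
      rw [← hz]
      calc y / z ≤ 4 * (v + 2) / z := by gcongr
        _ = _ := by ring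
    have h4 : 8 / z ≤ 20 * z := by
      rw [div_le_iff₀ hz0]
      nlinarith
    linarith
  · have h3 : y / x = 1 := by rw [hz]; exact div_self (by linarith)
    linarith

theorem opt_nonneg (n : ℕ) : 0 ≤ Opt n := by
  refine Real.sInf_nonneg ?_
  rintro x ⟨k, B, C, -, rfl⟩
  exact maxErr_nonneg B C

theorem mainTheorem2 :
    ∃ K : ℝ, 0 < K ∧
      (∀ n : ℕ, 1 ≤ n → |Opt n - Real.log n / Real.pi| ≤ K) ∧
      ∀ n n₁ m : ℕ, 2 ≤ n → 2 ≤ n₁ → 1 ≤ m →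
        ∃ (n' : ℕ) (B : Matrix (Fin n) (Fin n') ℝ) (C : Matrix (Fin n') (Fin n) ℝ)
          (s : ℕ) (p : StreamProg s),
          (n' : ℝ) ≤ K * n ∧
          B * C = prefixSumMatrix n ∧
          MaxErr B C ≤ Opt n * (1 + K / Real.log n₁) + K * Real.log n₁ ∧
          p.Multiplies B m (K * (n * Real.log n₁ ^ 2 * m)) ∧
          (p.space : ℝ) ≤ K * (Real.log n * Real.log n₁ * m) := by
  refine ⟨8000, by norm_num, fun n hn => (abs_opt_sub_le n hn).trans (by norm_num), ?_⟩
  intro n n₁ m hn hn₁ hm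
  -- The arity is capped at n so that the tree has a level below the root even when n₁ > n; that l ≥
  -- 1 is used in the space bound.
  obtain ⟨N, hN, hNn, hNn₁, hNeq⟩ : ∃ N : ℕ, 2 ≤ N ∧ N ≤ n ∧ N ≤ n₁ ∧ (n₁ = N ∨ n = N) :=
    ⟨min n₁ n, le_min hn₁ hn, min_le_right _ _, min_le_left _ _, by omega⟩
  obtain ⟨ι, _, τ, src, w, g, hcard, hbg, hb, hg⟩ := exists_fast_toeplitz N hN
  set l := Nat.log N n with hl
  -- A root with only as many children as needed keeps the number of leaves at most 2n; a complete
  -- tree could have about N times too many.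
  set a := n / N ^ l + 1 with ha
  have hR : 0 < N ^ l := by positivity
  have hRn : N ^ l ≤ n := Nat.pow_log_le_self N (by omega)
  have hnR : n < N ^ l * N := by
    rw [← pow_succ]; exact Nat.lt_pow_succ_log_self (by omega) n
  have haN : a ≤ N := Nat.div_lt_of_lt_mul hnR
  have hnR' : n < N ^ l * (n / N ^ l + 1) := Nat.lt_mul_div_succ n hR
  have haR : a * N ^ l = N ^ l * (n / N ^ l + 1) := mul_comm _ _
  have hdn : N ^ l * (n / N ^ l) ≤ n := Nat.mul_div_le n _
  have han : n ≤ a * N ^ l := by linarith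
  have ha2n : a * N ^ l ≤ 2 * n := by linarith
  have hl1 : 1 ≤ l := Nat.log_pos (by omega) hNn
  obtain ⟨C, hBC, herr⟩ := tree_factorization (by omega : 0 < N) hbg hb hg haN
    (by omega : 0 < n) han
  obtain ⟨s, p, T, hT, hspace, hmul⟩ := exists_streamProg hm τ src w hN l a n han
  have hx := lt_log_natCast hN
  have hxz : Real.log N ≤ Real.log n₁ :=
    Real.log_le_log (by positivity) (by exact_mod_cast hNn₁)
  have hlx : (l : ℝ) * Real.log N ≤ Real.log n := natLog_mul_log_le (by omega) (by omega)
  have hlam := natLog_two_succ_le hN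
  have hd : (Fintype.card ι : ℝ) ≤ 90 * Real.log N ^ 2 := by
    calc (Fintype.card ι : ℝ) ≤ 10 * (Nat.log 2 N + 1) ^ 2 := by exact_mod_cast hcard
      _ ≤ 10 * (3 * Real.log N) ^ 2 := by gcongr
      _ = _ := by ring
  have hm' : (1 : ℝ) ≤ m := by exact_mod_cast hm
  have hl' : (1 : ℝ) ≤ l := by exact_mod_cast hl1
  have hn' : (2 : ℝ) ≤ n := by exact_mod_cast hn
  -- This absorbs the additive constants 12 and 2 below into 26 log² N and 5 log² N.
  have hx2 : 0.47 ≤ Real.log N ^ 2 := by nlinarith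
  refine ⟨_, _, C, s, p, ?_, hBC, ?_, ?_, ?_⟩
  · have h1 := treeCols_add_two_le hN l
    have h2 : a * (treeCols N l + 1) ≤ a * (3 * N ^ l) := Nat.mul_le_mul_left a (by omega)
    have h3 : a * (treeCols N l + 1) ≤ 8000 * n := by nlinarith
    exact_mod_cast h3
  · refine herr.trans (le_trans ?_ (error_bound hx hxz (opt_nonneg n)
      (hNeq.imp (fun h => by rw [h]) (fun h => by rw [h])) (abs_opt_sub_le n (by omega))))
    have h1 : (l : ℝ) ≤ Real.log n / Real.log N := by rwa [le_div_iff₀ (by linarith)]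
    have h2 : (l : ℝ) * (Real.log N / Real.pi) ≤ Real.log n / Real.pi := by
      rw [← mul_div_assoc]
      exact div_le_div_of_nonneg_right hlx Real.pi_pos.le
    have h3 : Real.log N / Real.pi ≤ Real.log N :=
      div_le_self (by linarith) (by linarith [Real.pi_gt_three])
    linarith
  · intro Z
    obtain ⟨c, h1, h2, h3, h4⟩ := hmul Z
    refine ⟨c, h1, h2, h3, h4.trans ?_⟩
    have h5 : T ≤ m * (7 * Fintype.card ι + 12) * (11 * n) := by
      refine hT.trans (Nat.mul_le_mul ?_ (by omega))
      rw [roundTime]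
      nlinarith
    calc (T : ℝ) ≤ m * (7 * Fintype.card ι + 12) * (11 * n) := by exact_mod_cast h5
      _ ≤ m * (7 * (90 * Real.log N ^ 2) + 26 * Real.log N ^ 2) * (11 * n) := by
          gcongr
          linarith
      _ = 7216 * (n * Real.log N ^ 2 * m) := by ring
      _ ≤ 8000 * (n * Real.log n₁ ^ 2 * m) := by gcongr; norm_num
  · have h1 : (p.space : ℝ) ≤ 14 * ((l + 2) * (m * (Fintype.card ι + 1) + 1)) := by
      exact_mod_cast hspace
    calc (p.space : ℝ) ≤ 14 * ((l + 2) * (m * (Fintype.card ι + 1) + 1)) := h1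
      _ ≤ 14 * ((l + 2 * l) * (m * (Fintype.card ι + 1) + m)) := by gcongr; linarith
      _ = 42 * (l * (m * (Fintype.card ι + 2))) := by ring
      _ ≤ 42 * (l * (m * (90 * Real.log N ^ 2 + 5 * Real.log N ^ 2))) := by
          gcongr
          linarith
      _ = 3990 * (l * Real.log N * Real.log N * m) := by ring
      _ ≤ 8000 * (Real.log n * Real.log n₁ * m) := by gcongr; norm_num

end Main
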